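/- **Setting.** Let $s\ge1$, $d\ge1$, $b\ge2$ be integers and let $\mathcal X^{(1)},\dots,\mathcal X^{(s)}\subset\mathbb R^d$ be sets of Lebesgue volume $1$. Assume that $\mathcal X^{1:s}=\prod_{j}\mathcal X^{(j)}\subset\mathbb R^{ds}$ is Sobol' extensible: there is an anchor $\boldsymbol c\in\mathcal X^{1:s}$ such that, for every $\boldsymbol z\in\mathcal X^{1:s}$, the closed axis-parallel box spanned by $\boldsymbol c$ and $\boldsymbol z$ is contained in $\mathcal X^{1:s}$. A $b$-fold split of a set is a way of writing it as a union of $b$ Borel sets of equal volume with pairwise intersections of volume $0$. For each $j$ let a recursive $b$-fold split of $\mathcal X^{(j)}$ be given: cells $\mathcal X^{(j)}_{u_1,\dots,u_k}$ ($k\ge0$, $u_i\in\{0,\dots,b-1\}$), the cell of level $0$ being $\mathcal X^{(j)}$, such that the cells $\mathcal X^{(j)}_{u_1,\dots,u_k,c}$, $0\le c<b$, form a $b$-fold split of $\mathcal X^{(j)}_{u_1,\dots,u_k}$. Assume the sphericity condition: for some $C<\infty$, every cell of level $k$ has diameter at most $Cb^{-k/d}$. For digits $u_1,u_2,\dots$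 let $\phi_j(0.u_1u_2\dots)$ be the point to which the cells $\mathcal X^{(j)}_{u_1,\dots,u_K}$ shrink as $K\to\infty$. **Estimator.** A $(0,m,s)$-net in base $b$ consists of $n=b^m$ points $\boldsymbol a_1,\dots,\boldsymbol a_n\in[0,1]^s$ such that every box $\prod_{j}[c_jb^{-k_j},(c_j+1)b^{-k_j})$ with integers $k_j\ge0$, $0\le c_j<b^{k_j}$, $\sum_jk_j=m$ contains exactly one of them. Take independent uniformly random permutations $\pi_{j,w}$ of $\{0,\dots,b-1\}$, one for each $j$ and each finite word $w$ of digits. If $a_{ij}$ has base $b$ digits $\alpha_1,\alpha_2,\dots$ (the expansion ending in zeros being taken if there are two), its nested uniform scramble has the digits $u_{k+1}=\pi_{j,\alpha_1\dots\alpha_k}(\alpha_{k+1})$, $k\ge0$. The points $\boldsymbol x_i$ whose $j$-th component is $\phi_j$ of the scrambled $a_{ij}$ form a scrambled geometric net; put $\hat\mu=\frac1n\sum_{i=1}^nf(\boldsymbol x_i)$ and $\sigma^2_{sgn}=\mathrm{Var}(\hat\mu)$. **Integrands.** For $u\subseteq1{:}s$ let $\nabla^uf$ be the $d^{|u|}$-dimensional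 vector of the mixed partial derivatives $\partial^{|u|}f/\prod_{j\in u}\partial x_{j i_j}$, $1\le i_j\le d$ (taken within $\mathcal X^{1:s}$, so one-sided at the boundary). The class $\mathcal F_s$ consists of the functions $f$ on $\mathcal X^{1:s}$ for which there are $B\ge0$ and $\beta\in(0,1]$ such that for all $u\subseteq1{:}s$ the gradient $\nabla^uf$ exists and $\|\nabla^uf(\boldsymbol x)-\nabla^uf(\boldsymbol x^*)\|\le B\|\boldsymbol x-\boldsymbol x^*\|^\beta$ for all $\boldsymbol x,\boldsymbol x^*\in\mathcal X^{1:s}$, and $\bigl\|\int_{\mathcal X^{1:s}}\nabla^uf(\boldsymbol x)\,d\boldsymbol x\bigr\|^2>0$ for all $u\subseteq1{:}s$. **Theorem.** For a cell of $\mathcal X^{(j)}$ of level $k_j$ let $\boldsymbol w_j$ be its centroid, let $\boldsymbol n_{c}$, $0\le c<b$, be the centroids of the $b$ cells of level $k_j+1$ into which it is split, and let $$A_j=\sum_{c=0}^{b-1}(\boldsymbol n_{c}-\boldsymbol w_j)(\boldsymbol n_{c}-\boldsymbol w_j)^T .$$ Let $f\in\mathcal F_s$ and suppose that for some $\tilde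 c>0$ the smallest eigenvalue satisfies $\lambda_1(A_j)\ge\tilde c\,b^{-2k_j/d}$ for all $j=1,\dots,s$, all $k_j\ge0$ and all cells of level $k_j$ of $\mathcal X^{(j)}$. Then there are a constant $c>0$ and an integer $m_0$ such that, for all $m\ge m_0$ and every $(0,m,s)$-net in base $b$, the estimator $\hat\mu$ has finite second moment and $$\sigma^2_{sgn}\ \ge\ c\,\frac{(\log n)^{s-1}}{n^{1+2/d}},\qquad n=b^m .$$ -/

import Mathlib

open MeasureTheory ProbabilityTheory Filter Topology

universe v

noncomputable section

namespace GeomNet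

/-! Points of the product of `s` blocks, each block being a copy of `ℝ^d`. -/

/-- `d`-dimensional Euclidean space. -/
abbrev Block (d : ℕ) : Type := EuclideanSpace ℝ (Fin d)

/-- `(ℝ^d)^s`, with its Lebesgue measure. Euclidean distances are written out below, since the
default distance of a function type is the maximum over the blocks. -/
abbrev Pt (s d : ℕ) : Type := Fin s → Block d

/-- The Euclidean distance on `(ℝ^d)^s = ℝ^(ds)`. -/
def euclDist {s d : ℕ} (x y : Pt s d) : ℝ :=
  Real.sqrt (∑ j, ‖x j - y j‖ ^ 2)

/-! ### Recursive splits -/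

/-- `Y 0, …, Y (b - 1)` is a `b`-fold split of `S`. -/
structure IsSplit {d : ℕ} (b : ℕ) (S : Set (Block d)) (Y : Fin b → Set (Block d)) : Prop where
  measurable : ∀ c, MeasurableSet (Y c)
  union : S = ⋃ c, Y c
  vol : ∀ c, volume (Y c) = volume S / b
  null_inter : ∀ c c', c ≠ c' → volume (Y c ∩ Y c') = 0

/-- A recursive `b`-fold split of `S`: the cells of level `k` are indexed by the words
`(u₁, …, u_k)` of digits (equivalently by the numbers `t < b ^ k` with these digits), and the cells
`(u₁, …, u_k, c)` for `c = 0, …, b - 1` form a `b`-fold split of the cell `(u₁, …, u_k)`. -/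
structure RecursiveSplit {d : ℕ} (b : ℕ) (S : Set (Block d)) where
  cell : (k : ℕ) → (Fin k → Fin b) → Set (Block d)
  cell_zero : ∀ w : Fin 0 → Fin b, cell 0 w = S
  isSplit : ∀ (k : ℕ) (w : Fin k → Fin b),
    IsSplit b (cell k w) (fun c => cell (k + 1) (Fin.snoc (α := fun _ => Fin b) w c))

/-- The sphericity condition: every cell of level `k` has diameter at most `C * b ^ (-k / d)`. -/
def RecursiveSplit.Spherical {d b : ℕ} {S : Set (Block d)} (T : RecursiveSplit b S) : Prop :=
  ∃ C : ℝ, 0 < C ∧ ∀ (k : ℕ) (w : Fin k → Fin b), ∀ x ∈ T.cell k w, ∀ y ∈ T.cell k w,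
    dist x y ≤ C * (b : ℝ) ^ (-((k : ℝ) / (d : ℝ)))

/-- The transformation `φ` of a recursive split, as a function of the base `b` digits
`u = (u₁, u₂, …)`: the point to which the cells `(u₁, …, u_K)` shrink as `K → ∞`, that is, each
neighbourhood of which contains these cells for all large `K`. (For a spherical split of a set of
positive volume there is exactly one such point for every `u`.) -/
def RecursiveSplit.transform {d b : ℕ} {S : Set (Block d)} (T : RecursiveSplit b S)
    (u : ℕ → Fin b) : Block d :=
  Classical.epsilon fun x =>
    Tendsto (fun K : ℕ => T.cell K (fun l : Fin K => u l)) atTop (𝓝 x).smallSets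

/-! ### Centers and the matrices `A_j` -/

/-- The center (centroid) of a set. -/
def center {d : ℕ} (S : Set (Block d)) : Block d := ⨍ x in S, x ∂volume

/-- The matrix `∑_c (n_c - w) (n_c - w)ᵀ`, where `w` is the center of the (wide) cell with digits
`w` at level `k`, and `n_c` are the centers of its `b` children, the narrow cells. -/
def RecursiveSplit.centerMatrix {d b : ℕ} {S : Set (Block d)} (T : RecursiveSplit b S)
    (k : ℕ) (w : Fin k → Fin b) : Matrix (Fin d) (Fin d) ℝ :=
  ∑ c : Fin b, Matrix.vecMulVec
    (fun p => (center (T.cell (k + 1) (Fin.snoc (α := fun _ => Fin b) w c))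
      - center (T.cell k w)) p)
    (fun p => (center (T.cell (k + 1) (Fin.snoc (α := fun _ => Fin b) w c))
      - center (T.cell k w)) p)

theorem RecursiveSplit.centerMatrix_isHermitian {d b : ℕ} {S : Set (Block d)}
    (T : RecursiveSplit b S) (k : ℕ) (w : Fin k → Fin b) : (T.centerMatrix k w).IsHermitian := by
  ext p q
  simp [RecursiveSplit.centerMatrix, Matrix.sum_apply, Matrix.vecMulVec_apply, mul_comm]

/-- The smallest eigenvalue of a real symmetric matrix. -/
def minEigenvalue {d : ℕ} {A : Matrix (Fin d) (Fin d) ℝ} (hA : A.IsHermitian) : ℝ :=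
  ⨅ i, hA.eigenvalues i

/-! ### Sobol' extensible regions and the class of integrands -/

/-- `X` is Sobol' extensible: there is an anchor `c ∈ X` such that with each point `z` the set `X`
contains the whole axis-parallel box spanned by `c` and `z`. -/
def SobolExtensible {s d : ℕ} (X : Set (Pt s d)) : Prop :=
  ∃ c ∈ X, ∀ z ∈ X, ∀ y : Pt s d, (∀ j i, y j i ∈ Set.uIcc (c j i) (z j i)) → y ∈ X

/-- Move the `i`-th coordinate of the `j`-th block of `x` by `t`. -/
def shift {s d : ℕ} (x : Pt s d) (j : Fin s) (i : Fin d) (t : ℝ) : Pt s d :=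
  Function.update x j (x j + t • EuclideanSpace.single i (1 : ℝ))

/-- A candidate for all the mixed gradients of a function: for each set `u` of blocks and each
point, a vector with one coordinate for each choice `η = (i_j)_{j ∈ u}` of one coordinate direction
in every block of `u`. -/
abbrev GradFamily (s d : ℕ) : Type :=
  (u : Finset (Fin s)) → Pt s d → EuclideanSpace ℝ ({j // j ∈ u} → Fin d)

/-- `D u` is the order-`u` gradient `∇^u f` on `X`, for every `u`: the `η`-coordinate of `D u` is
the mixed partial derivative of `f`, taken once in the coordinate `η j` of each block `j ∈ u`.
The derivatives are along the coordinate lines within `X`, hence one-sided at the boundary. -/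
structure IsMixedGradient {s d : ℕ} (X : Set (Pt s d)) (f : Pt s d → ℝ)
    (D : GradFamily s d) : Prop where
  empty : ∀ x ∈ X, ∀ η, D ∅ x η = f x
  insert : ∀ (u : Finset (Fin s)) (j : Fin s), j ∉ u →
    ∀ η : {l // l ∈ insert j u} → Fin d, ∀ x ∈ X,
      HasDerivWithinAt
        (fun t : ℝ => D u (shift x j (η ⟨j, Finset.mem_insert_self j u⟩) t)
          (fun l => η ⟨l, Finset.mem_insert_of_mem l.2⟩))
        (D (insert j u) x η)
        {t : ℝ | shift x j (η ⟨j, Finset.mem_insert_self j u⟩) t ∈ X} 0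

/-- All the mixed gradients are Hölder continuous on `X`. -/
def HolderOn {s d : ℕ} (X : Set (Pt s d)) (D : GradFamily s d) : Prop :=
  ∃ B β : ℝ, 0 ≤ B ∧ 0 < β ∧ β ≤ 1 ∧ ∀ u : Finset (Fin s), ∀ x ∈ X, ∀ y ∈ X,
    ‖D u x - D u y‖ ≤ B * euclDist x y ^ β

/-- The class of smooth functions on `X` all of whose mixed gradients have nonzero integral. -/
def SmoothClass {s d : ℕ} (X : Set (Pt s d)) : Set (Pt s d → ℝ) :=
  {f | ∃ D : GradFamily s d, IsMixedGradient X f D ∧ HolderOn X D ∧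
    ∀ u : Finset (Fin s), 0 < ‖∫ x in X, D u x‖ ^ 2}

/-! ### Nets and nested uniform scrambling -/

/-- `a₁, …, a_{b^m} ∈ [0,1]^s` is a `(t, m, s)`-net in base `b`: every `b`-adic box with sides
`b ^ (-k_j)` of volume `b ^ (t - m)` contains exactly `b ^ t` of the points. -/
structure IsNet {s : ℕ} (b t m : ℕ) (a : Fin (b ^ m) → Fin s → ℝ) : Prop where
  le : t ≤ m
  mem : ∀ i j, a i j ∈ Set.Icc (0 : ℝ) 1
  card : ∀ k c : Fin s → ℕ, (∀ j, c j < b ^ k j) → ∑ j, k j + t = m →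
    {i | ∀ j, a i j ∈ Set.Ico ((c j : ℝ) / (b : ℝ) ^ k j)
      (((c j : ℝ) + 1) / (b : ℝ) ^ k j)}.ncard = b ^ t

/-- The labels of the permutations used in a scramble: a block `j` and a finite word of digits. -/
abbrev PermIndex (s b : ℕ) : Type := Fin s × (Σ k : ℕ, (Fin k → Fin b))

/-- The finite set of permutations carries the discrete σ-algebra. -/
instance instMeasurableSpacePerm (b : ℕ) : MeasurableSpace (Equiv.Perm (Fin b)) := ⊤

/-- The permutations are independent and uniformly distributed on all `b!` permutations of the
digits. -/
structure IsUniformScramble {s b : ℕ} {Ω : Type v} [MeasurableSpace Ω] (P : Measure Ω)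
    (π : PermIndex s b → Ω → Equiv.Perm (Fin b)) : Prop where
  measurable : ∀ q, Measurable (π q)
  indep : iIndepFun π P
  uniform : ∀ q σ, P {ω | π q ω = σ} = ((b.factorial : ℕ) : ENNReal)⁻¹

/-- The base `b` digits of the `j`-th coordinate of the scramble of a point: the `(k+1)`-st digit
of the point is permuted by the permutation labelled by its first `k` digits. (`Real.digits` are
the digits of the expansion that does not end in digits `b - 1` only.) -/
def scrambleDigits {s b : ℕ} [NeZero b] (σ : PermIndex s b → Equiv.Perm (Fin b))
    (a : Fin s → ℝ) (j : Fin s) : ℕ → Fin b :=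
  fun k => σ (j, ⟨k, fun l : Fin k => (a j).digits b l⟩) ((a j).digits b k)

/-- The point of the scrambled geometric net that comes from the point `a` of the net. -/
def scrambledPoint {s d b : ℕ} [NeZero b] {X : Fin s → Set (Block d)}
    (T : ∀ j, RecursiveSplit b (X j)) (σ : PermIndex s b → Equiv.Perm (Fin b))
    (a : Fin s → ℝ) : Pt s d :=
  fun j => (T j).transform (scrambleDigits σ a j)

/-- The estimator `μ̂`, the mean of `f` over the `n = b ^ m` points of the scrambled geometric
net. -/
def estimator {s d b m : ℕ} [NeZero b] {X : Fin s → Set (Block d)}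
    (T : ∀ j, RecursiveSplit b (X j)) (f : Pt s d → ℝ) (a : Fin (b ^ m) → Fin s → ℝ)
    (σ : PermIndex s b → Equiv.Perm (Fin b)) : ℝ :=
  (1 / (b : ℝ) ^ m) * ∑ i, f (scrambledPoint T σ (a i))

end GeomNet

end

noncomputable section
namespace GeomNet

/-! ### Mixed differences -/

/-! A point is identified with the digit sequences of the cells that shrink to it. For a multi-index
κ, the contrast of level κ is obtained from f by applying in every block j the difference between
averaging over cells of level κ_j + 1 (narrow) and of level κ_j (wide). It depends only on the
digits of index at most κ_j, and it sums to zero over the digit of index κ_j of any one block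
(`sum_contrast_update`).

Scrambling gives each single point of the net uniformly distributed digits
(`measurePreserving_scrambleDigits`). If the κ_j sum to m, distinct points of the net lie in
different boxes of sides b^(-κ_j), so in some block j their first κ_j digits differ
(`IsNet.exists_digits_ne`). The digit of index κ_j of one point is then scrambled by a permutation
that no digit of the other uses. Hence the contrast at one point is orthogonal to every integrable
function of the digits of the other (`integral_mul_contrast_eq_zero`). Contrasts of different levels
of sum m are orthogonal to each other, and to what is left of f after they are subtracted. So their
sum over the net has the variance that independent points would give, and σ² is at least 1/n times
the sum of their mean squares (`le_variance_estimator`).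

It remains to bound one mean square from below. A contrast is the expectation of the mixed
difference of f between independent points of the narrow and the wide cell of every block. When all
κ_j are large, this is the contraction of G, the mean of ∇^{1:s} f over the product of the wide
cells, with the vectors n_j - w_j, up to an error that is small relative to ∏ b^(-κ_j/d)
(`abs_contrast_sub_le`). Summed over the b^s choices of children, the squares of these contractions
form a quadratic form in G whose matrix is the Kronecker product of the A_j, hence are at least c₀^s
b^(-2m/d) |G|² (`prod_mul_sum_sq_le_sum_sq`). By Jensen's inequality the mean of |G|² is at least |∫
∇^{1:s} f|² > 0. So every level κ of sum m with all entries at least some k₀ contributes a multiple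
of n^(-2/d), and there are at least of the order of m^(s-1) such levels (`le_card_levels`). -/

theorem exists_mem_uIcc_between (c y z : ℝ) :
    ∃ q, q ∈ Set.uIcc y z ∧ q ∈ Set.uIcc c y ∧ q ∈ Set.uIcc c z := by
  simp only [Set.mem_uIcc]
  rcases le_total c y with h1 | h1 <;> rcases le_total c z with h2 | h2 <;>
    rcases le_total y z with h3 | h3
  all_goals first
    | exact ⟨y, by grind⟩
    | exact ⟨z, by grind⟩
    | exact ⟨c, by grind⟩

/-- The mean value inequality for h - G t along a coordinate segment. Derivatives are given only at
parameter 0 of the line through each point, so they are first translated to every parameter of the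
segment. -/
theorem abs_sub_sub_le_of_segment {d : ℕ} {h : Block d → ℝ} {h' : Block d → ℝ} {S : Set (Block d)}
    {i : Fin d} {p : Block d} {G E δ : ℝ}
    (hseg : ∀ t ∈ Set.uIcc 0 δ, p + t • EuclideanSpace.single i (1 : ℝ) ∈ S)
    (hderiv : ∀ p ∈ S, HasDerivWithinAt (fun t : ℝ => h (p + t • EuclideanSpace.single i (1 : ℝ)))
      (h' p) {t : ℝ | p + t • EuclideanSpace.single i (1 : ℝ) ∈ S} 0)
    (hG : ∀ p ∈ S, |h' p - G| ≤ E) :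
    |h (p + δ • EuclideanSpace.single i (1 : ℝ)) - h p - G * δ| ≤ E * |δ| := by
  set e : Block d := EuclideanSpace.single i (1 : ℝ)
  have key : ∀ t ∈ Set.uIcc 0 δ, HasDerivWithinAt (fun t : ℝ => h (p + t • e) - G * t)
      (h' (p + t • e) - G) (Set.uIcc 0 δ) t := by
    intro t ht
    have h1 := hderiv _ (hseg t ht)
    have h2 : HasDerivWithinAt (fun τ : ℝ => τ - t) 1 (Set.uIcc 0 δ) t :=
      (hasDerivWithinAt_id t _).sub_const t
    have h3 : HasDerivWithinAt
        ((fun τ : ℝ => h (p + t • e + τ • e)) ∘ (fun τ : ℝ => τ - t))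
        (h' (p + t • e) * 1) (Set.uIcc 0 δ) t := by
      refine HasDerivWithinAt.comp (s' := {τ : ℝ | p + t • e + τ • e ∈ S}) t ?_ h2 ?_
      · simpa using h1
      · intro τ hτ
        have := hseg τ hτ
        simp only [Set.mem_ofPred_eq]
        convert this using 1
        module
    have h4 : ((fun τ : ℝ => h (p + t • e + τ • e)) ∘ (fun τ : ℝ => τ - t))
        = fun τ => h (p + τ • e) := by
      funext τ
      simp only [Function.comp]
      congr 1
      module
    rw [h4, mul_one] at h3
    have h5 : HasDerivWithinAt (fun τ : ℝ => G * τ) (G * 1) (Set.uIcc 0 δ) t :=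
      (hasDerivWithinAt_id t _).const_mul G
    rw [mul_one] at h5
    exact h3.sub h5
  have := (convex_uIcc (0 : ℝ) δ).norm_image_sub_le_of_norm_hasDerivWithin_le key
    (fun t ht => by simpa using hG _ (hseg t ht)) Set.left_mem_uIcc Set.right_mem_uIcc
  simp only [Real.norm_eq_abs, zero_smul, add_zero, mul_zero, sub_zero] at this
  convert this using 2
  ring

/-- The coordinates of `q` are changed into those of `y` one at a time; every segment of this path
lies in the box. -/
theorem abs_sub_sub_sum_le_of_box {d : ℕ} {h : Block d → ℝ} {h' : Fin d → Block d → ℝ}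
    {S : Set (Block d)} {q y : Block d} {G : Fin d → ℝ} {E : ℝ}
    (hbox : ∀ p : Block d, (∀ i, p i ∈ Set.uIcc (q i) (y i)) → p ∈ S)
    (hderiv : ∀ p ∈ S, ∀ i,
      HasDerivWithinAt (fun t : ℝ => h (p + t • EuclideanSpace.single i (1 : ℝ)))
        (h' i p) {t : ℝ | p + t • EuclideanSpace.single i (1 : ℝ) ∈ S} 0)
    (hG : ∀ p ∈ S, ∀ i, |h' i p - G i| ≤ E) :
    |h y - h q - ∑ i, G i * (y i - q i)| ≤ E * ∑ i, |y i - q i| := by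
  have key : ∀ I : Finset (Fin d),
      |h (WithLp.toLp 2 fun i => if i ∈ I then y i else q i) - h q - ∑ i ∈ I, G i * (y i - q i)|
        ≤ E * ∑ i ∈ I, |y i - q i| := by
    intro I
    induction I using Finset.induction_on with
    | empty => simp
    | insert i I hi ih =>
      have h1 := abs_sub_sub_le_of_segment (h := h) (h' := h' i) (S := S) (i := i)
        (p := WithLp.toLp 2 fun l => if l ∈ I then y l else q l) (G := G i) (E := E)
        (δ := y i - q i) (fun t ht => hbox _ fun l => by
          rcases eq_or_ne l i with rfl | hl
          · simp only [PiLp.add_apply, PiLp.smul_apply, PiLp.single_apply, hi, if_true,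
              if_false, smul_eq_mul, mul_one]
            rw [Set.mem_uIcc] at ht ⊢
            rcases ht with ht | ht
            · left; constructor <;> linarith [ht.1, ht.2]
            · right; constructor <;> linarith [ht.1, ht.2]
          · simp only [PiLp.add_apply, PiLp.smul_apply, PiLp.single_apply, hl,
              if_false, smul_eq_mul, mul_zero, add_zero]
            split_ifs
            · exact Set.right_mem_uIcc
            · exact Set.left_mem_uIcc)
        (fun p hp => hderiv p hp i) (fun p hp => hG p hp i)
      have h2 : (WithLp.toLp 2 fun l => if l ∈ I then y l else q l : Block d)
          + (y i - q i) • EuclideanSpace.single i (1 : ℝ)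
          = WithLp.toLp 2 fun l => if l ∈ insert i I then y l else q l := by
        ext l
        rcases eq_or_ne l i with rfl | hl
        · simp [hi]
        · simp [hl]
      rw [h2] at h1
      rw [Finset.sum_insert hi, Finset.sum_insert hi, mul_add]
      rw [abs_le] at *
      constructor <;> linarith [h1.1, h1.2, ih.1, ih.2]
  have := key Finset.univ
  simpa using this

/-- The box spanned by `y` and `z` need not lie in the region. The path therefore goes through the
coordinatewise median `q` of the anchor, `y` and `z`. The boxes from `q` to `y` and to `z` lie in
the region by extensibility and also in the box of `y` and `z`. Since `q` is between `y` and `z` in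
each coordinate, the ℓ¹ lengths of the two legs add up exactly. -/
theorem abs_sub_sub_sum_le_of_anchor {d : ℕ} {h : Block d → ℝ} {h' : Fin d → Block d → ℝ}
    {S₀ S : Set (Block d)} {c y z : Block d} {G : Fin d → ℝ} {E : ℝ}
    (hc : ∀ z ∈ S₀, ∀ p : Block d, (∀ i, p i ∈ Set.uIcc (c i) (z i)) → p ∈ S₀)
    (hy : y ∈ S₀) (hz : z ∈ S₀)
    (hS : ∀ p ∈ S₀, (∀ i, p i ∈ Set.uIcc (y i) (z i)) → p ∈ S)
    (hderiv : ∀ p ∈ S, ∀ i,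
      HasDerivWithinAt (fun t : ℝ => h (p + t • EuclideanSpace.single i (1 : ℝ)))
        (h' i p) {t : ℝ | p + t • EuclideanSpace.single i (1 : ℝ) ∈ S} 0)
    (hG : ∀ p ∈ S, ∀ i, |h' i p - G i| ≤ E) :
    |h y - h z - ∑ i, G i * (y i - z i)| ≤ E * ∑ i, |y i - z i| := by
  choose q hq using fun i => exists_mem_uIcc_between (c i) (y i) (z i)
  simp only [Set.mem_uIcc] at hq
  have h1 := abs_sub_sub_sum_le_of_box (q := WithLp.toLp 2 q) (y := y)
    (fun p hp => hS p (hc y hy p fun i => by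
      have h1 := hq i
      have h2 := hp i
      simp only [Set.mem_uIcc] at h2 ⊢
      grind) fun i => by
      have h1 := hq i
      have h2 := hp i
      simp only [Set.mem_uIcc] at h2 ⊢
      grind) hderiv hG
  have h2 := abs_sub_sub_sum_le_of_box (q := WithLp.toLp 2 q) (y := z)
    (fun p hp => hS p (hc z hz p fun i => by
      have h1 := hq i
      have h2 := hp i
      simp only [Set.mem_uIcc] at h2 ⊢
      grind) fun i => by
      have h1 := hq i
      have h2 := hp i
      simp only [Set.mem_uIcc] at h2 ⊢
      grind) hderiv hG
  have h3 : ∑ i, |y i - z i| = ∑ i, |y i - q i| + ∑ i, |z i - q i| := by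
    rw [← Finset.sum_add_distrib]
    refine Finset.sum_congr rfl fun i _ => ?_
    have h1 := hq i
    grind
  have h4 : ∑ i, G i * (y i - z i) = ∑ i, G i * (y i - q i) - ∑ i, G i * (z i - q i) := by
    rw [← Finset.sum_sub_distrib]
    exact Finset.sum_congr rfl fun i _ => by ring
  rw [h3, h4, mul_add]
  simp only [abs_le] at *
  constructor <;> linarith [h1.1, h1.2, h2.1, h2.2]

/-- The mixed difference of `g` in the blocks of `u` between `z` and `y`, the other blocks being
those of `x`. -/
def mixedDiff {s d : ℕ} (u : Finset (Fin s)) (y z : Pt s d) (g : Pt s d → ℝ) (x : Pt s d) : ℝ :=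
  ∑ v ∈ u.powerset, (-1) ^ v.card * g (fun l => if l ∈ v then z l else if l ∈ u then y l else x l)

theorem mixedDiff_insert {s d : ℕ} {u : Finset (Fin s)} {j : Fin s} (hj : j ∉ u) (y z : Pt s d)
    (g : Pt s d → ℝ) (x : Pt s d) :
    mixedDiff (insert j u) y z g x = mixedDiff u y z g (Function.update x j (y j))
      - mixedDiff u y z g (Function.update x j (z j)) := by
  unfold mixedDiff
  rw [Finset.sum_powerset_insert hj, sub_eq_add_neg, ← Finset.sum_neg_distrib]
  congr 1
  · refine Finset.sum_congr rfl fun v hv => ?_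
    rw [Finset.mem_powerset] at hv
    congr 2
    funext l
    rcases eq_or_ne l j with rfl | hl
    · have : l ∉ v := fun h => hj (hv h)
      simp [hj, this]
    · simp [hl]
  · refine Finset.sum_congr rfl fun v hv => ?_
    rw [Finset.mem_powerset] at hv
    have hjv : j ∉ v := fun h => hj (hv h)
    rw [Finset.card_insert_of_notMem hjv, pow_succ]
    simp only [mul_neg, mul_one, neg_mul, neg_inj]
    congr 2
    funext l
    rcases eq_or_ne l j with rfl | hl
    · simp [hj, hjv]
    · simp [hl]

theorem hasDerivWithinAt_mixedDiff {s d : ℕ} {u : Finset (Fin s)} {j : Fin s} (hj : j ∉ u)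
    {X : Fin s → Set (Block d)} {y z x : Pt s d} {g g' : Pt s d → ℝ} {i : Fin d}
    (hg : ∀ x ∈ Set.univ.pi X, HasDerivWithinAt (fun t : ℝ => g (shift x j i t)) (g' x)
      {t : ℝ | shift x j i t ∈ Set.univ.pi X} 0)
    (hy : ∀ l, y l ∈ X l) (hz : ∀ l, z l ∈ X l) (hx : ∀ l, x l ∈ X l) {p : Block d} (hp : p ∈ X j)
    {S : Set (Block d)} (hS : S ⊆ X j) :
    HasDerivWithinAt (fun t : ℝ => mixedDiff u y z g
        (Function.update x j (p + t • EuclideanSpace.single i (1 : ℝ))))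
      (mixedDiff u y z g' (Function.update x j p))
      {t : ℝ | p + t • EuclideanSpace.single i (1 : ℝ) ∈ S} 0 := by
  unfold mixedDiff
  refine HasDerivWithinAt.fun_sum fun v hv => HasDerivWithinAt.const_mul _ ?_
  rw [Finset.mem_powerset] at hv
  have hjv : j ∉ v := fun h => hj (hv h)
  set P : Block d → Pt s d := fun p l =>
    if l ∈ v then z l else if l ∈ u then y l else Function.update x j p l with hP
  have hPX : ∀ p ∈ X j, P p ∈ Set.univ.pi X := by
    intro p hp l _
    simp only [hP]
    split_ifs
    · exact hz l
    · exact hy l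
    · rcases eq_or_ne l j with rfl | hl
      · simpa using hp
      · simpa [hl] using hx l
  have hPs : ∀ t : ℝ, P (p + t • EuclideanSpace.single i (1 : ℝ)) = shift (P p) j i t := by
    intro t
    funext l
    unfold shift
    rcases eq_or_ne l j with rfl | hl
    · simp [hP, hj, hjv]
    · simp [hP, hl]
  have := (hg (P p) (hPX p hp)).mono
    (s := {t : ℝ | p + t • EuclideanSpace.single i (1 : ℝ) ∈ S}) (fun t ht => by
      simp only [Set.mem_ofPred_eq] at ht ⊢
      rw [← hPs]
      exact hPX _ (hS ht))
  simp only [← hPs] at this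
  exact this

/-- The main part of a mixed difference of order `u`, with the coefficients `G`. -/
def tensorPart {s d : ℕ} (u : Finset (Fin s)) (y z : Pt s d) (G : (Fin s → Fin d) → ℝ)
    (η : Fin s → Fin d) : ℝ :=
  ∑ η' ∈ Fintype.piFinset (fun l => if l ∈ u then Finset.univ else {η l}),
    G η' * ∏ l ∈ u, (y l (η' l) - z l (η' l))

theorem tensorPart_insert {s d : ℕ} {u : Finset (Fin s)} {j : Fin s} (hj : j ∉ u) (y z : Pt s d)
    (G : (Fin s → Fin d) → ℝ) (η : Fin s → Fin d) :
    tensorPart (insert j u) y z G η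
      = ∑ i, tensorPart u y z G (Function.update η j i) * (y j i - z j i) := by
  unfold tensorPart
  rw [← Finset.sum_fiberwise _ (fun η' : Fin s → Fin d => η' j)]
  refine Finset.sum_congr rfl fun i _ => ?_
  rw [Finset.sum_mul]
  refine Finset.sum_congr ?_ fun η' hη' => ?_
  · ext η'
    simp only [Finset.mem_filter, Fintype.mem_piFinset]
    constructor
    · rintro ⟨h1, h2⟩ l
      rcases eq_or_ne l j with rfl | hl
      · simp [hj, h2]
      · have := h1 l
        simpa [hl] using this
    · intro h
      have hij : η' j = i := by simpa [hj] using h j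
      refine ⟨fun l => ?_, hij⟩
      rcases eq_or_ne l j with rfl | hl
      · simp
      · simpa [hl] using h l
  · have hij : η' j = i := by
      have := Fintype.mem_piFinset.1 hη' j
      simpa [hj] using this
    rw [Finset.prod_insert hj, hij]
    ring

/-- Induction over the blocks of `u`. The difference in the blocks of `u` is taken of the derivative
in all the other blocks. Joining `j` to `u` trades the derivative in block `j` for a difference
there, and the inductive bound is exactly the control of derivatives that the one-block estimate
needs. -/
theorem abs_mixedDiff_sub_tensorPart_le {s d : ℕ} {X : Fin s → Set (Block d)} {c : Pt s d}
    (hc : ∀ j, ∀ z ∈ X j, ∀ p : Block d, (∀ i, p i ∈ Set.uIcc (c j i) (z i)) → p ∈ X j)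
    {F : Finset (Fin s) → (Fin s → Fin d) → Pt s d → ℝ}
    (hF : ∀ v j, j ∉ v → ∀ η i, ∀ x ∈ Set.univ.pi X,
      HasDerivWithinAt (fun t : ℝ => F v η (shift x j i t))
        (F (insert j v) (Function.update η j i) x) {t : ℝ | shift x j i t ∈ Set.univ.pi X} 0)
    {y z : Pt s d} (hy : ∀ l, y l ∈ X l) (hz : ∀ l, z l ∈ X l) {G : (Fin s → Fin d) → ℝ} {ε : ℝ}
    (hG : ∀ x ∈ Set.univ.pi X, (∀ l i, x l i ∈ Set.uIcc (y l i) (z l i)) → ∀ η,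
      |F Finset.univ η x - G η| ≤ ε) (u : Finset (Fin s)) :
    ∀ η, ∀ x ∈ Set.univ.pi X, (∀ l i, x l i ∈ Set.uIcc (y l i) (z l i)) →
      |mixedDiff u y z (F uᶜ η) x - tensorPart u y z G η|
        ≤ ε * ∏ l ∈ u, ∑ i, |y l i - z l i| := by
  induction u using Finset.induction_on with
  | empty =>
    intro η x hx hx'
    have : Fintype.piFinset (fun l => ({η l} : Finset (Fin d))) = {η} := by
      simp
    simpa [mixedDiff, tensorPart, this] using hG x hx hx' η
  | insert j u hj ih =>
    intro η x hx hx'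
    have hju : j ∉ (insert j u)ᶜ := by simp
    have hu : insert j (insert j u)ᶜ = uᶜ := by
      ext l
      rcases eq_or_ne l j with rfl | hl
      · simp [hj]
      · simp [hl]
    have hxX : ∀ l, x l ∈ X l := fun l => hx l trivial
    have h1 := abs_sub_sub_sum_le_of_anchor
      (h := fun p => mixedDiff u y z (F (insert j u)ᶜ η) (Function.update x j p))
      (h' := fun i p => mixedDiff u y z (F uᶜ (Function.update η j i)) (Function.update x j p))
      (S := {p | p ∈ X j ∧ ∀ i, p i ∈ Set.uIcc (y j i) (z j i)}) (c := c j)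
      (G := fun i => tensorPart u y z G (Function.update η j i))
      (E := ε * ∏ l ∈ u, ∑ i, |y l i - z l i|)
      (hc j) (hy j) (hz j) (fun p h1 h2 => ⟨h1, h2⟩)
      (fun p hp i => by
        refine hasDerivWithinAt_mixedDiff hj (fun x hx => ?_) hy hz hxX hp.1 (fun _ h => h.1)
        rw [← hu]
        exact hF _ j hju η i x hx)
      (fun p hp i => by
        refine ih (Function.update η j i) (Function.update x j p) (fun l _ => ?_) (fun l => ?_)
        · rcases eq_or_ne l j with rfl | hl
          · simpa using hp.1
          · simpa [hl] using hxX l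
        · rcases eq_or_ne l j with rfl | hl
          · simpa using hp.2
          · simpa [hl] using hx' l)
    rw [mixedDiff_insert hj, tensorPart_insert hj, Finset.prod_insert hj]
    refine h1.trans (le_of_eq ?_)
    ring

theorem abs_mixedDiff_univ_sub_le {s d : ℕ} {X : Fin s → Set (Block d)} {c : Pt s d}
    (hc : ∀ j, ∀ z ∈ X j, ∀ p : Block d, (∀ i, p i ∈ Set.uIcc (c j i) (z i)) → p ∈ X j)
    {F : Finset (Fin s) → (Fin s → Fin d) → Pt s d → ℝ}
    (hF : ∀ v j, j ∉ v → ∀ η i, ∀ x ∈ Set.univ.pi X,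
      HasDerivWithinAt (fun t : ℝ => F v η (shift x j i t))
        (F (insert j v) (Function.update η j i) x) {t : ℝ | shift x j i t ∈ Set.univ.pi X} 0)
    {y z : Pt s d} (hy : ∀ l, y l ∈ X l) (hz : ∀ l, z l ∈ X l) {G : (Fin s → Fin d) → ℝ} {ε : ℝ}
    (hG : ∀ x ∈ Set.univ.pi X, (∀ l i, x l i ∈ Set.uIcc (y l i) (z l i)) → ∀ η,
      |F Finset.univ η x - G η| ≤ ε) (η₀ : Fin s → Fin d) :
    |∑ v : Finset (Fin s), (-1) ^ v.card * F ∅ η₀ (fun l => if l ∈ v then z l else y l)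
        - ∑ η : Fin s → Fin d, G η * ∏ l, (y l (η l) - z l (η l))|
      ≤ ε * ∏ l, ∑ i, |y l i - z l i| := by
  have h := abs_mixedDiff_sub_tensorPart_le hc hF hy hz hG Finset.univ η₀ y (fun l _ => hy l)
    (fun l i => Set.left_mem_uIcc)
  simpa [mixedDiff, tensorPart] using h

end GeomNet
end

noncomputable section
namespace GeomNet

/-! ### Quadratic forms -/

theorem minEigenvalue_mul_le {d : ℕ} {A : Matrix (Fin d) (Fin d) ℝ} (hA : A.IsHermitian)
    (g : Fin d → ℝ) : minEigenvalue hA * ∑ i, g i ^ 2 ≤ g ⬝ᵥ (A.mulVec g) := by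
  set v := hA.eigenvectorBasis
  set x : EuclideanSpace ℝ (Fin d) := WithLp.toLp 2 g
  set y : EuclideanSpace ℝ (Fin d) := WithLp.toLp 2 (A.mulVec g)
  have h1 : ∑ i, g i ^ 2 = ∑ i, inner ℝ x (v i) * inner ℝ (v i) x := by
    rw [v.sum_inner_mul_inner, real_inner_self_eq_norm_sq, EuclideanSpace.norm_sq_eq]
    simp [x]
  have h2 : g ⬝ᵥ (A.mulVec g) = ∑ i, inner ℝ x (v i) * inner ℝ (v i) y := by
    rw [v.sum_inner_mul_inner]
    simp [x, y, PiLp.inner_apply, dotProduct, mul_comm]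
  have h3 : ∀ i, inner ℝ (v i) y = hA.eigenvalues i * inner ℝ (v i) x := by
    intro i
    have h4 : A.mulVec (v i).ofLp = hA.eigenvalues i • (v i).ofLp := hA.mulVec_eigenvectorBasis i
    have h5 : A.transpose = A := by simpa [Matrix.IsHermitian] using hA
    have h6 : inner ℝ (v i) y = (v i).ofLp ⬝ᵥ (A.mulVec g) := by
      simp [y, PiLp.inner_apply, dotProduct, mul_comm]
    have h7 : inner ℝ (v i) x = (v i).ofLp ⬝ᵥ g := by
      simp [x, PiLp.inner_apply, dotProduct, mul_comm]
    rw [h6, h7, Matrix.dotProduct_mulVec, ← Matrix.mulVec_transpose, h5, h4, smul_dotProduct,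
      smul_eq_mul]
  rw [h1, h2, Finset.mul_sum]
  refine Finset.sum_le_sum fun i _ => ?_
  rw [h3, real_inner_comm]
  have : minEigenvalue hA ≤ hA.eigenvalues i := ciInf_le (Set.finite_range _).bddBelow i
  nlinarith [mul_self_nonneg (inner ℝ (v i) x)]

theorem RecursiveSplit.minEigenvalue_mul_le_sum {d b : ℕ} {S : Set (Block d)}
    (T : RecursiveSplit b S) (k : ℕ) (w : Fin k → Fin b) (g : Fin d → ℝ) :
    minEigenvalue (T.centerMatrix_isHermitian k w) * ∑ i, g i ^ 2 ≤
      ∑ c : Fin b, (∑ i, g i * (center (T.cell (k + 1) (Fin.snoc (α := fun _ => Fin b) w c))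
        - center (T.cell k w)) i) ^ 2 := by
  refine (minEigenvalue_mul_le (T.centerMatrix_isHermitian k w) g).trans (le_of_eq ?_)
  simp only [RecursiveSplit.centerMatrix, Matrix.sum_mulVec, dotProduct_sum]
  refine Finset.sum_congr rfl fun c _ => ?_
  rw [Matrix.vecMulVec_mulVec, dotProduct_smul, sq]
  simp only [dotProduct, MulOpposite.smul_eq_mul_unop, MulOpposite.unop_op]
  congr 1
  exact Finset.sum_congr rfl fun i _ => mul_comm _ _

theorem sum_fin_succ_pi {n : ℕ} {α : Type*} [Fintype α] (g : (Fin (n + 1) → α) → ℝ) :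
    ∑ η, g η = ∑ i, ∑ η : Fin n → α, g (Fin.cons i η) := by
  rw [← Fintype.sum_prod_type']
  exact (Fintype.sum_equiv (Fin.consEquiv fun _ => α) _ _ fun _ => rfl).symm

/-- The smallest eigenvalue of a Kronecker product of positive semidefinite matrices is the product
of the smallest eigenvalues. In the induction, block 0 is treated with the other indices of `G`
frozen, and the remaining blocks act on the tensor contracted with `a 0 c₀`. -/
theorem prod_mul_sum_sq_le_sum_sq {d b s : ℕ} (a : Fin s → Fin b → Fin d → ℝ) (lam : Fin s → ℝ)
    (hlam : ∀ j, 0 ≤ lam j)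
    (ha : ∀ j (g : Fin d → ℝ), lam j * ∑ i, g i ^ 2 ≤ ∑ c, (∑ i, g i * a j c i) ^ 2)
    (G : (Fin s → Fin d) → ℝ) :
    (∏ j, lam j) * ∑ η, G η ^ 2 ≤
      ∑ c : Fin s → Fin b, (∑ η, G η * ∏ j, a j (c j) (η j)) ^ 2 := by
  induction s with
  | zero => simp
  | succ n ih =>
    have h1 := fun c₀ => ih (fun j => a j.succ) (fun j => lam j.succ) (fun j => hlam _)
      (fun j => ha _) (fun η => ∑ i, G (Fin.cons i η) * a 0 c₀ i)
    have h2 := fun η : Fin n → Fin d => ha 0 (fun i => G (Fin.cons i η))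
    rw [Fin.prod_univ_succ, sum_fin_succ_pi, sum_fin_succ_pi]
    calc (lam 0 * ∏ i : Fin n, lam i.succ) * ∑ i, ∑ η : Fin n → Fin d, G (Fin.cons i η) ^ 2
        = (∏ i : Fin n, lam i.succ) *
          ∑ η : Fin n → Fin d, lam 0 * ∑ i, G (Fin.cons i η) ^ 2 := by
          rw [Finset.sum_comm, ← Finset.mul_sum]
          ring
      _ ≤ (∏ i : Fin n, lam i.succ) *
          ∑ η : Fin n → Fin d, ∑ c₀, (∑ i, G (Fin.cons i η) * a 0 c₀ i) ^ 2 :=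
          mul_le_mul_of_nonneg_left (Finset.sum_le_sum fun η _ => h2 η)
            (Finset.prod_nonneg fun j _ => hlam _)
      _ = ∑ c₀, (∏ i : Fin n, lam i.succ) *
          ∑ η : Fin n → Fin d, (∑ i, G (Fin.cons i η) * a 0 c₀ i) ^ 2 := by
          rw [Finset.sum_comm, Finset.mul_sum]
      _ ≤ ∑ c₀, ∑ c : Fin n → Fin b, (∑ η : Fin n → Fin d,
          (∑ i, G (Fin.cons i η) * a 0 c₀ i) * ∏ j, a j.succ (c j) (η j)) ^ 2 :=
          Finset.sum_le_sum fun c₀ _ => h1 c₀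
      _ = _ := by
          refine Finset.sum_congr rfl fun c₀ _ => Finset.sum_congr rfl fun c _ => ?_
          congr 1
          rw [sum_fin_succ_pi, Finset.sum_comm]
          refine Finset.sum_congr rfl fun η _ => ?_
          rw [Finset.sum_mul]
          refine Finset.sum_congr rfl fun i _ => ?_
          rw [Fin.prod_univ_succ]
          simp only [Fin.cons_zero, Fin.cons_succ]
          ring

/-! ### Counting compositions -/

/-- The multi-indices of total degree `m` with all entries at least `k₀`. -/
def levels (s m k₀ : ℕ) : Finset (Fin s → ℕ) :=
  (Finset.piAntidiag Finset.univ m).filter fun κ => ∀ j, k₀ ≤ κ j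

theorem mem_levels {s m k₀ : ℕ} {κ : Fin s → ℕ} :
    κ ∈ levels s m k₀ ↔ ∑ j, κ j = m ∧ ∀ j, k₀ ≤ κ j := by
  simp [levels, Finset.mem_piAntidiag]

theorem pow_le_card_levels {s m k₀ q : ℕ} (h : (s + 1) * (k₀ + q) ≤ m) :
    q ^ s ≤ (levels (s + 1) m k₀).card := by
  have h1 : q ^ s = (Finset.univ : Finset (Fin s → Fin q)).card := by simp
  rw [h1]
  have hsum : ∀ e : Fin s → Fin q, ∑ j, (k₀ + (e j : ℕ)) ≤ s * (k₀ + q) := by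
    intro e
    refine (Finset.sum_le_sum (g := fun _ => k₀ + q) fun j _ => ?_).trans (by simp)
    have := (e j).2
    omega
  -- The last s entries are chosen freely in [k₀, k₀ + q); the first one takes up the remainder,
  -- which is still at least k₀.
  refine Finset.card_le_card_of_injOn
    (fun e => Fin.cons (m - ∑ j, (k₀ + (e j : ℕ))) fun j => k₀ + (e j : ℕ)) ?_ ?_
  · intro e _
    have h2 := hsum e
    have h3 : (s + 1) * (k₀ + q) = s * (k₀ + q) + (k₀ + q) := by ring
    rw [Finset.mem_coe, mem_levels]
    constructor
    · rw [Fin.sum_univ_succ]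
      simp only [Fin.cons_zero, Fin.cons_succ]
      omega
    · intro j
      refine Fin.cases ?_ (fun j => ?_) j
      · simp only [Fin.cons_zero]
        omega
      · simp
  · intro e _ e' _ hee
    funext j
    have := congrFun hee j.succ
    simp only [Fin.cons_succ] at this
    exact Fin.ext (by omega)

theorem le_card_levels {s m k₀ : ℕ} (hs : 1 ≤ s) (hm : 2 * s * (k₀ + 1) ≤ m) :
    ((m : ℝ) / (4 * s)) ^ (s - 1) ≤ (levels s m k₀).card := by
  obtain ⟨s, rfl⟩ : ∃ n, s = n + 1 := ⟨s - 1, by omega⟩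
  -- With S = s + 1 blocks, this q is at least k₀ + 1. Hence S (k₀ + q) ≤ 2 S q ≤ m, and m < 2 S (q
  -- + 1) ≤ 4 S q.
  set q := m / (2 * (s + 1)) with hq
  have h2 : 2 * (s + 1) * q ≤ m := Nat.mul_div_le m _
  have h1 : (s + 1) * (k₀ + q) ≤ m := by nlinarith
  have h3 : k₀ + 1 ≤ q := by
    rw [hq, Nat.le_div_iff_mul_le (by positivity)]
    linarith
  have h4 : m < 2 * (s + 1) * (q + 1) := by
    have := Nat.lt_mul_div_succ m (show 0 < 2 * (s + 1) by positivity)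
    simpa [hq] using this
  have h5 : (m : ℝ) / (4 * ((s + 1 : ℕ) : ℝ)) ≤ q := by
    rw [div_le_iff₀ (by positivity)]
    have : m ≤ q * (4 * (s + 1)) := by nlinarith
    exact_mod_cast this
  calc ((m : ℝ) / (4 * ((s + 1 : ℕ) : ℝ))) ^ (s + 1 - 1) ≤ (q : ℝ) ^ s := by
        rw [Nat.add_sub_cancel]
        gcongr
    _ ≤ _ := by exact_mod_cast pow_le_card_levels h1

end GeomNet
end

noncomputable section
namespace GeomNet

/-! ### Cells of a recursive split -/

theorem tendsto_diam {d b : ℕ} (hd : 1 ≤ d) (hb : 2 ≤ b) (C : ℝ) :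
    Tendsto (fun k : ℕ => C * (b : ℝ) ^ (-((k : ℝ) / (d : ℝ)))) atTop (𝓝 0) := by
  have hd' : (0 : ℝ) < d := by exact_mod_cast hd
  have hb' : (1 : ℝ) < b := by exact_mod_cast hb
  have h1 : ∀ k : ℕ, (b : ℝ) ^ (-((k : ℝ) / (d : ℝ))) = ((b : ℝ) ^ (-(1 / (d : ℝ)))) ^ k := by
    intro k
    rw [← Real.rpow_natCast, ← Real.rpow_mul (by positivity)]
    congr 1
    ring
  have h2 : (b : ℝ) ^ (-(1 / (d : ℝ))) < 1 :=
    Real.rpow_lt_one_of_one_lt_of_neg hb' (neg_lt_zero.2 (by positivity))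
  have := (tendsto_pow_atTop_nhds_zero_of_lt_one (by positivity) h2).const_mul C
  simpa [h1] using this

namespace RecursiveSplit

variable {d b : ℕ} {S : Set (Block d)} (T : RecursiveSplit b S)

theorem cell_eq_iUnion (k : ℕ) (w : Fin k → Fin b) :
    T.cell k w = ⋃ c, T.cell (k + 1) (Fin.snoc (α := fun _ => Fin b) w c) :=
  (T.isSplit k w).union

theorem measurableSet_cell (k : ℕ) (w : Fin k → Fin b) : MeasurableSet (T.cell k w) := by
  rw [T.cell_eq_iUnion]
  exact MeasurableSet.iUnion fun c => (T.isSplit k w).measurable c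

theorem measurableSet_base (T : RecursiveSplit b S) : MeasurableSet S := by
  rw [← T.cell_zero Fin.elim0]
  exact T.measurableSet_cell _ _

theorem cell_succ_subset (k : ℕ) (w : Fin (k + 1) → Fin b) :
    T.cell (k + 1) w ⊆ T.cell k (fun l => w l.castSucc) := by
  rw [T.cell_eq_iUnion k]
  refine Set.subset_iUnion_of_subset (w (Fin.last k)) (le_of_eq ?_)
  congr 1
  exact (Fin.snoc_init_self (α := fun _ => Fin b) w).symm

theorem cell_subset (k : ℕ) (w : Fin k → Fin b) : T.cell k w ⊆ S := by
  induction k with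
  | zero => exact (T.cell_zero w).le
  | succ k ih => exact (T.cell_succ_subset k w).trans (ih _)

theorem volume_cell (hS : volume S = 1) (k : ℕ) (w : Fin k → Fin b) :
    volume (T.cell k w) = ((b : ENNReal) ^ k)⁻¹ := by
  induction k with
  | zero => simp [T.cell_zero, hS]
  | succ k ih =>
    have h := (T.isSplit k (fun l => w l.castSucc)).vol (w (Fin.last k))
    rw [show Fin.snoc (α := fun _ => Fin b) (fun l => w l.castSucc) (w (Fin.last k)) = w from
      Fin.snoc_init_self (α := fun _ => Fin b) w, ih] at h
    rw [h, pow_succ, ENNReal.mul_inv (Or.inr (ENNReal.natCast_ne_top b)) (Or.inl (by simp)),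
      div_eq_mul_inv]

theorem volume_inter_cell (k : ℕ) {w w' : Fin k → Fin b} (hw : w ≠ w') :
    volume (T.cell k w ∩ T.cell k w') = 0 := by
  induction k with
  | zero => exact absurd (Subsingleton.elim w w') hw
  | succ k ih =>
    by_cases hi : (fun l : Fin k => w l.castSucc) = fun l => w' l.castSucc
    · have hl : w (Fin.last k) ≠ w' (Fin.last k) := by
        intro hl
        refine hw ?_
        rw [← Fin.snoc_init_self (α := fun _ => Fin b) w,
          ← Fin.snoc_init_self (α := fun _ => Fin b) w']
        exact congrArg₂ (Fin.snoc (α := fun _ => Fin b)) hi hl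
      have h := (T.isSplit k (fun l => w l.castSucc)).null_inter _ _ hl
      have h1 : Fin.snoc (α := fun _ => Fin b) (fun l => w l.castSucc) (w (Fin.last k)) = w :=
        Fin.snoc_init_self (α := fun _ => Fin b) w
      have h2 : Fin.snoc (α := fun _ => Fin b) (fun l => w l.castSucc) (w' (Fin.last k)) = w' := by
        rw [hi]
        exact Fin.snoc_init_self (α := fun _ => Fin b) w'
      rwa [h1, h2] at h
    · exact measure_mono_null
        (Set.inter_subset_inter (T.cell_succ_subset k w) (T.cell_succ_subset k w')) (ih hi)

theorem volume_cell_ne_zero (hS : volume S = 1) (k : ℕ) (w : Fin k → Fin b) :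
    volume (T.cell k w) ≠ 0 := by
  rw [T.volume_cell hS]
  exact ENNReal.inv_ne_zero.2 (ENNReal.pow_ne_top (ENNReal.natCast_ne_top b))

theorem nonempty_cell (hS : volume S = 1) (k : ℕ) (w : Fin k → Fin b) :
    (T.cell k w).Nonempty :=
  nonempty_of_measure_ne_zero (T.volume_cell_ne_zero hS k w)

theorem volume_cell_ne_top (hb : b ≠ 0) (hS : volume S = 1) (k : ℕ) (w : Fin k → Fin b) :
    volume (T.cell k w) ≠ ⊤ := by
  rw [T.volume_cell hS]
  simp [hb]

/-- The cell of level `k` with the first `k` digits of `u`. -/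
def cellAt (u : ℕ → Fin b) (k : ℕ) : Set (Block d) := T.cell k fun l => u l

theorem cellAt_antitone (u : ℕ → Fin b) : Antitone (T.cellAt u) :=
  antitone_nat_of_succ_le fun k => T.cell_succ_subset k _

/-! ### The transformation -/

/-- Cells have positive volume, so a point can be chosen in each; nestedness and shrinking diameters
make these points a Cauchy sequence. The limit need not belong to the cells, which are not assumed
closed. -/
theorem tendsto_transform (hd : 1 ≤ d) (hb : 2 ≤ b) (hS : volume S = 1) (hT : T.Spherical)
    (u : ℕ → Fin b) : Tendsto (T.cellAt u) atTop (𝓝 (T.transform u)).smallSets := by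
  refine Classical.epsilon_spec
    (p := fun x => Tendsto (fun K : ℕ => T.cell K (fun l : Fin K => u l)) atTop (𝓝 x).smallSets) ?_
  obtain ⟨C, hC, hdiam⟩ := hT
  choose y hy using fun k : ℕ => T.nonempty_cell hS k fun l => u l
  have hcau : CauchySeq y := by
    refine cauchySeq_of_le_tendsto_0 _ (fun n m N hn hm => ?_) (tendsto_diam hd hb C)
    exact hdiam N _ _ (T.cellAt_antitone u hn (hy n)) _ (T.cellAt_antitone u hm (hy m))
  obtain ⟨x, hx⟩ := cauchySeq_tendsto_of_complete hcau
  refine ⟨x, tendsto_smallSets_iff.2 fun U hU => ?_⟩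
  obtain ⟨ε, hε, hεU⟩ := Metric.mem_nhds_iff.1 hU
  have h1 := (tendsto_diam hd hb C).eventually (gt_mem_nhds (half_pos hε))
  have h2 := (Metric.tendsto_nhds.1 hx) (ε / 2) (half_pos hε)
  filter_upwards [h1, h2] with K hK1 hK2 z hz
  refine hεU ?_
  rw [Metric.mem_ball]
  calc dist z x ≤ dist z (y K) + dist (y K) x := dist_triangle _ _ _
    _ < ε / 2 + ε / 2 := add_lt_add ((hdiam K _ _ hz _ (hy K)).trans_lt hK1) hK2
    _ = ε := add_halves ε

theorem tendsto_of_mem_cellAt (hd : 1 ≤ d) (hb : 2 ≤ b) (hS : volume S = 1) (hT : T.Spherical)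
    (u : ℕ → Fin b) {y : ℕ → Block d} (hy : ∀ k, y k ∈ T.cellAt u k) :
    Tendsto y atTop (𝓝 (T.transform u)) := by
  refine tendsto_def.2 fun U hU => ?_
  filter_upwards [tendsto_smallSets_iff.1 (T.tendsto_transform hd hb hS hT u) U hU] with K hK
  exact hK (hy K)

/-- The transformation is a pointwise limit of functions of finitely many digits. -/
theorem measurable_transform (hd : 1 ≤ d) (hb : 2 ≤ b) (hS : volume S = 1) (hT : T.Spherical) :
    Measurable T.transform := by
  choose y hy using fun (k : ℕ) (w : Fin k → Fin b) => T.nonempty_cell hS k w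
  refine measurable_of_tendsto_metrizable
    (f := fun (k : ℕ) (u : ℕ → Fin b) => y k fun l => u l) (fun k => ?_)
    (tendsto_pi_nhds.2 fun u => T.tendsto_of_mem_cellAt hd hb hS hT u fun k => hy k _)
  exact (Measurable.of_discrete (f := y k)).comp
    (measurable_pi_lambda _ fun l => measurable_pi_apply _)

/-! ### The address of a point -/

variable [NeZero b]

open Classical in
/-- The index of the first child of the cell `w` that contains `x`. -/
def child (k : ℕ) (w : Fin k → Fin b) (x : Block d) : Fin b :=
  if h : ∃ c, x ∈ T.cell (k + 1) (Fin.snoc (α := fun _ => Fin b) w c) ∧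
    ∀ c' < c, x ∉ T.cell (k + 1) (Fin.snoc (α := fun _ => Fin b) w c') then h.choose else 0

theorem mem_cell_child {k : ℕ} {w : Fin k → Fin b} {x : Block d} (hx : x ∈ T.cell k w) :
    x ∈ T.cell (k + 1) (Fin.snoc (α := fun _ => Fin b) w (T.child k w x)) := by
  rw [T.cell_eq_iUnion, Set.mem_iUnion] at hx
  have h : ∃ c, x ∈ T.cell (k + 1) (Fin.snoc (α := fun _ => Fin b) w c) ∧
      ∀ c' < c, x ∉ T.cell (k + 1) (Fin.snoc (α := fun _ => Fin b) w c') := by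
    obtain ⟨c, hc, hmin⟩ := WellFounded.has_min (wellFounded_lt (α := Fin b))
      {c | x ∈ T.cell (k + 1) (Fin.snoc (α := fun _ => Fin b) w c)} hx
    exact ⟨c, hc, fun c' hc' h => hmin c' h hc'⟩
  rw [child, dif_pos h]
  exact h.choose_spec.1

theorem measurable_child (k : ℕ) (w : Fin k → Fin b) : Measurable (T.child k w) := by
  have hm : ∀ c, MeasurableSet {x | x ∈ T.cell (k + 1) (Fin.snoc (α := fun _ => Fin b) w c) ∧
      ∀ c' < c, x ∉ T.cell (k + 1) (Fin.snoc (α := fun _ => Fin b) w c')} := by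
    intro c
    have : {x | x ∈ T.cell (k + 1) (Fin.snoc (α := fun _ => Fin b) w c) ∧
        ∀ c' < c, x ∉ T.cell (k + 1) (Fin.snoc (α := fun _ => Fin b) w c')} =
        T.cell (k + 1) (Fin.snoc (α := fun _ => Fin b) w c) ∩
        ⋂ c', ⋂ (_ : c' < c), (T.cell (k + 1) (Fin.snoc (α := fun _ => Fin b) w c'))ᶜ := by
      ext x
      simp
    rw [this]
    refine (T.measurableSet_cell _ _).inter ?_
    exact MeasurableSet.iInter fun c' => MeasurableSet.iInter fun _ =>
      (T.measurableSet_cell _ _).compl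
  refine measurable_to_countable' fun c => ?_
  have : T.child k w ⁻¹' {c} =
      {x | x ∈ T.cell (k + 1) (Fin.snoc (α := fun _ => Fin b) w c) ∧
        ∀ c' < c, x ∉ T.cell (k + 1) (Fin.snoc (α := fun _ => Fin b) w c')} ∪
      ((⋃ c, {x | x ∈ T.cell (k + 1) (Fin.snoc (α := fun _ => Fin b) w c) ∧
        ∀ c' < c, x ∉ T.cell (k + 1) (Fin.snoc (α := fun _ => Fin b) w c')})ᶜ ∩ {_x | c = 0}) := by
    ext x
    simp only [Set.mem_preimage, Set.mem_singleton_iff, Set.mem_union, Set.mem_inter_iff,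
      Set.mem_compl_iff, Set.mem_iUnion, Set.mem_ofPred_eq]
    by_cases h : ∃ c, x ∈ T.cell (k + 1) (Fin.snoc (α := fun _ => Fin b) w c) ∧
      ∀ c' < c, x ∉ T.cell (k + 1) (Fin.snoc (α := fun _ => Fin b) w c')
    · rw [child, dif_pos h]
      have h1 := h.choose_spec
      constructor
      · rintro rfl
        exact Or.inl h1
      · rintro (h2 | h2)
        · rcases lt_trichotomy h.choose c with h3 | h3 | h3
          · exact absurd h1.1 (h2.2 _ h3)
          · exact h3
          · exact absurd h2.1 (h1.2 _ h3)
        · exact absurd h h2.1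
    · rw [child, dif_neg h]
      constructor
      · exact fun h2 => Or.inr ⟨h, h2.symm⟩
      · rintro (h2 | h2)
        · exact absurd ⟨c, h2⟩ h
        · exact h2.2.symm
  rw [this]
  exact (hm c).union ((MeasurableSet.iUnion hm).compl.inter (MeasurableSet.const _))

/-- The digits of the cell of level `k` that is found for `x` by descending into first children. -/
def word (x : Block d) : (k : ℕ) → Fin k → Fin b
  | 0 => Fin.elim0
  | k + 1 => Fin.snoc (α := fun _ => Fin b) (word x k) (T.child k (word x k) x)

/-- The digits of a decreasing sequence of cells that contain `x`. -/
def address (x : Block d) (k : ℕ) : Fin b := T.child k (T.word x k) x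

theorem word_eq (x : Block d) (k : ℕ) : T.word x k = fun l : Fin k => T.address x l := by
  induction k with
  | zero => exact Subsingleton.elim _ _
  | succ k ih =>
    funext l
    refine Fin.lastCases ?_ (fun l => ?_) l
    · simp [word, address]
    · simp only [word, Fin.snoc_castSucc, Fin.val_castSucc]
      rw [ih]

theorem mem_cell_word {x : Block d} (hx : x ∈ S) (k : ℕ) : x ∈ T.cell k (T.word x k) := by
  induction k with
  | zero => rwa [T.cell_zero]
  | succ k ih => exact T.mem_cell_child ih

theorem mem_cellAt_address {x : Block d} (hx : x ∈ S) (k : ℕ) : x ∈ T.cellAt (T.address x) k := by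
  rw [cellAt, ← T.word_eq]
  exact T.mem_cell_word hx k

theorem measurable_word (k : ℕ) : Measurable fun x => T.word x k := by
  induction k with
  | zero => exact measurable_of_subsingleton_codomain _
  | succ k ih =>
    have h1 : Measurable fun p : (Fin k → Fin b) × Block d =>
        (Fin.snoc (α := fun _ => Fin b) p.1 (T.child k p.1 p.2) : Fin (k + 1) → Fin b) :=
      measurable_from_prod_countable_right fun w =>
        (Measurable.of_discrete (f := fun c : Fin b =>
          (Fin.snoc (α := fun _ => Fin b) w c : Fin (k + 1) → Fin b))).comp (T.measurable_child k w)
    exact h1.comp (ih.prodMk measurable_id)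

theorem measurable_address : Measurable T.address := by
  refine measurable_pi_lambda _ fun k => ?_
  have h1 : Measurable fun p : (Fin k → Fin b) × Block d => T.child k p.1 p.2 :=
    measurable_from_prod_countable_right fun w => T.measurable_child k w
  exact h1.comp ((T.measurable_word k).prodMk measurable_id)

/-- Choosing first children resolves the overlaps of the cells, which are null sets. So the points
with a given initial address fill their cell up to a null set. -/
theorem restrict_word_eq (k : ℕ) (w : Fin k → Fin b) :
    volume.restrict ({x | (fun l : Fin k => T.address x l) = w} ∩ S)
      = volume.restrict (T.cell k w) := by
  have hsub : {x | (fun l : Fin k => T.address x l) = w} ∩ S ⊆ T.cell k w := by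
    rintro x ⟨hx, hxS⟩
    have := T.mem_cell_word hxS k
    rw [T.word_eq] at this
    rwa [hx] at this
  refine Measure.restrict_congr_set (Filter.EventuallyLE.antisymm hsub.eventuallyLE ?_)
  rw [ae_le_set]
  refine measure_mono_null (t := ⋃ w' : {w' // w' ≠ w}, T.cell k w'.1 ∩ T.cell k w) ?_ ?_
  · rintro x ⟨hx, hx'⟩
    have hxS := T.cell_subset k w hx
    have h1 := T.mem_cell_word hxS k
    refine Set.mem_iUnion.2 ⟨⟨T.word x k, fun h => hx' ⟨?_, hxS⟩⟩, h1, hx⟩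
    rw [T.word_eq] at h
    exact h
  · exact measure_iUnion_null fun w' => T.volume_inter_cell k w'.2

theorem transform_address (hd : 1 ≤ d) (hb : 2 ≤ b) (hS : volume S = 1) (hT : T.Spherical)
    {x : Block d} (hx : x ∈ S) : T.transform (T.address x) = x :=
  tendsto_nhds_unique
    (T.tendsto_of_mem_cellAt hd hb hS hT _ (y := fun _ => x) fun k => T.mem_cellAt_address hx k)
    tendsto_const_nhds

end RecursiveSplit

end GeomNet
end

noncomputable section
namespace GeomNet

/-! ### Products of cells -/

theorem RecursiveSplit.isProbabilityMeasure_cond {d b : ℕ} {S : Set (Block d)}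
    (T : RecursiveSplit b S) (hb : b ≠ 0) (hS : volume S = 1) (k : ℕ) (w : Fin k → Fin b) :
    IsProbabilityMeasure (volume[|T.cell k w]) :=
  cond_isProbabilityMeasure_of_finite (T.volume_cell_ne_zero hS k w)
    (T.volume_cell_ne_top hb hS k w)

theorem RecursiveSplit.cellAt_congr {d b : ℕ} {S : Set (Block d)}
    (T : RecursiveSplit b S) {u u' : ℕ → Fin b} {k : ℕ} (h : ∀ l < k, u l = u' l) :
    T.cellAt u k = T.cellAt u' k := by
  unfold RecursiveSplit.cellAt
  congr 1
  funext l
  exact h l l.2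

theorem RecursiveSplit.cellAt_update_succ {d b : ℕ} {S : Set (Block d)}
    (T : RecursiveSplit b S) (u : ℕ → Fin b) (k : ℕ) (c : Fin b) :
    T.cellAt (Function.update u k c) (k + 1)
      = T.cell (k + 1) (Fin.snoc (α := fun _ => Fin b) (fun l : Fin k => u l) c) := by
  unfold RecursiveSplit.cellAt
  congr 1
  funext l
  refine Fin.lastCases ?_ (fun l => ?_) l
  · simp
  · have : (l : ℕ) ≠ k := l.2.ne
    simp [this]

theorem RecursiveSplit.sum_cond_cellAt_update {d b : ℕ} {S : Set (Block d)}
    (T : RecursiveSplit b S) (hb : b ≠ 0) (u : ℕ → Fin b) (k : ℕ) :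
    ∑ c, volume[|T.cellAt (Function.update u k c) (k + 1)]
      = (b : ENNReal) • volume[|T.cellAt u k] := by
  have h := T.isSplit k fun l => u l
  have h1 : ∑ c, volume.restrict (T.cellAt (Function.update u k c) (k + 1))
      = volume.restrict (T.cellAt u k) := by
    simp only [T.cellAt_update_succ]
    rw [RecursiveSplit.cellAt, h.union, Measure.restrict_iUnion_ae
      (fun c c' hc => h.null_inter c c' hc) (fun c => (h.measurable c).nullMeasurableSet),
      Measure.sum_fintype]
  have h2 : ∀ c, volume (T.cellAt (Function.update u k c) (k + 1)) = volume (T.cellAt u k) / b :=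
    fun c => by
      rw [T.cellAt_update_succ]
      exact h.vol c
  simp only [ProbabilityTheory.cond, h2]
  rw [← Finset.smul_sum, h1, ENNReal.inv_div (Or.inl (ENNReal.natCast_ne_top b))
    (Or.inl (by exact_mod_cast hb)), smul_smul, div_eq_mul_inv]

variable {s d b : ℕ} {X : Fin s → Set (Block d)} (T : ∀ j, RecursiveSplit b (X j))

theorem measurableSet_region (T : ∀ j, RecursiveSplit b (X j)) : MeasurableSet (Set.univ.pi X) :=
  MeasurableSet.univ_pi fun j => (T j).measurableSet_base

/-- The product of the uniform distributions on the cells of levels `κ j` with digits `u j`. -/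
def cellPi (κ : Fin s → ℕ) (u : Fin s → ℕ → Fin b) : Measure (Pt s d) :=
  Measure.pi fun j => volume[|(T j).cellAt (u j) (κ j)]

/-- The product of the cells of levels `κ j` with digits `u j`. -/
def cellBox (κ : Fin s → ℕ) (u : Fin s → ℕ → Fin b) : Set (Pt s d) :=
  Set.univ.pi fun j => (T j).cellAt (u j) (κ j)

/-- The mean of `g` over a product of cells. -/
def cellMean (g : Pt s d → ℝ) (κ : Fin s → ℕ) (u : Fin s → ℕ → Fin b) : ℝ :=
  ∫ x, g x ∂(cellPi T κ u)

theorem isProbabilityMeasure_cellPi (hb : b ≠ 0) (hvol : ∀ j, volume (X j) = 1)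
    (κ : Fin s → ℕ) (u : Fin s → ℕ → Fin b) : IsProbabilityMeasure (cellPi T κ u) := by
  have := fun j => (T j).isProbabilityMeasure_cond hb (hvol j) (κ j) fun l => u j l
  unfold cellPi RecursiveSplit.cellAt
  infer_instance

theorem measurableSet_cellBox (κ : Fin s → ℕ) (u : Fin s → ℕ → Fin b) :
    MeasurableSet (cellBox T κ u) :=
  MeasurableSet.univ_pi fun j => (T j).measurableSet_cell _ _

theorem cellBox_subset (κ : Fin s → ℕ) (u : Fin s → ℕ → Fin b) :
    cellBox T κ u ⊆ Set.univ.pi X :=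
  Set.pi_mono fun j _ => (T j).cell_subset _ _

theorem volume_cellBox (κ : Fin s → ℕ) (u : Fin s → ℕ → Fin b) :
    volume (cellBox T κ u) = ∏ j, volume ((T j).cellAt (u j) (κ j)) := by
  rw [cellBox, volume_pi_pi]

theorem volume_cellBox_ne_zero (hvol : ∀ j, volume (X j) = 1)
    (κ : Fin s → ℕ) (u : Fin s → ℕ → Fin b) : volume (cellBox T κ u) ≠ 0 := by
  rw [volume_cellBox]
  exact Finset.prod_ne_zero_iff.2 fun j _ => (T j).volume_cell_ne_zero (hvol j) _ _

theorem volume_cellBox_ne_top (hb : b ≠ 0) (hvol : ∀ j, volume (X j) = 1)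
    (κ : Fin s → ℕ) (u : Fin s → ℕ → Fin b) : volume (cellBox T κ u) ≠ ⊤ := by
  rw [volume_cellBox]
  exact ENNReal.prod_ne_top fun j _ => (T j).volume_cell_ne_top hb (hvol j) _ _

theorem cellPi_eq_cond (hb : b ≠ 0) (hvol : ∀ j, volume (X j) = 1)
    (κ : Fin s → ℕ) (u : Fin s → ℕ → Fin b) : cellPi T κ u = volume[|cellBox T κ u] := by
  have : ∀ j, IsProbabilityMeasure (volume[|(T j).cellAt (u j) (κ j)]) :=
    fun j => (T j).isProbabilityMeasure_cond hb (hvol j) (κ j) fun l => u j l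
  refine Measure.pi_eq fun t ht => ?_
  rw [cond_apply (measurableSet_cellBox T κ u), volume_cellBox, cellBox, ← Set.pi_inter_distrib,
    volume_pi_pi, ENNReal.prod_inv_distrib]
  · rw [← Finset.prod_mul_distrib]
    exact Finset.prod_congr rfl fun j _ => (cond_apply ((T j).measurableSet_cell _ _) _ _).symm
  · intro i _ j _ _
    exact Or.inl ((T i).volume_cell_ne_zero (hvol i) _ _)

theorem cellPi_congr {κ : Fin s → ℕ} {u u' : Fin s → ℕ → Fin b}
    (h : ∀ j, ∀ l < κ j, u j l = u' j l) : cellPi T κ u = cellPi T κ u' := by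
  unfold cellPi
  congr 1
  funext j
  rw [(T j).cellAt_congr (h j)]

theorem cellMean_congr (g : Pt s d → ℝ) {κ : Fin s → ℕ} {u u' : Fin s → ℕ → Fin b}
    (h : ∀ j, ∀ l < κ j, u j l = u' j l) : cellMean T g κ u = cellMean T g κ u' := by
  unfold cellMean
  rw [cellPi_congr T h]

theorem integrable_cellPi (hb : b ≠ 0) (hvol : ∀ j, volume (X j) = 1) {g : Pt s d → ℝ}
    (hg : IntegrableOn g (Set.univ.pi X)) (κ : Fin s → ℕ) (u : Fin s → ℕ → Fin b) :
    Integrable g (cellPi T κ u) := by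
  rw [cellPi_eq_cond T hb hvol]
  exact (hg.mono_set (cellBox_subset T κ u)).integrable.smul_measure
    (ENNReal.inv_ne_top.2 (volume_cellBox_ne_zero T hvol κ u))

theorem setIntegral_cellBox (hb : b ≠ 0) (hvol : ∀ j, volume (X j) = 1) (g : Pt s d → ℝ)
    (κ : Fin s → ℕ) (u : Fin s → ℕ → Fin b) :
    ∫ x in cellBox T κ u, g x = volume.real (cellBox T κ u) * cellMean T g κ u := by
  rw [cellMean, cellPi_eq_cond T hb hvol, ProbabilityTheory.cond, integral_smul_measure,
    smul_eq_mul, ← mul_assoc, ENNReal.toReal_inv, Measure.real, mul_inv_cancel₀, one_mul]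
  exact (ENNReal.toReal_pos (volume_cellBox_ne_zero T hvol κ u)
    (volume_cellBox_ne_top T hb hvol κ u)).ne'

/-! ### Averaging over cells -/

section

variable [NeZero b]

/-- The addresses of the blocks of a point. -/
def blockAddress (x : Pt s d) (j : Fin s) : ℕ → Fin b := (T j).address (x j)

theorem measurable_blockAddress : Measurable (blockAddress T) :=
  measurable_pi_lambda _ fun j => (T j).measurable_address.comp (measurable_pi_apply j)

/-- The points whose addresses start with the digits `w`. -/
def addressFiber (κ : Fin s → ℕ) (w : ∀ j, Fin (κ j) → Fin b) : Set (Pt s d) :=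
  {x | (fun j (l : Fin (κ j)) => blockAddress T x j l) = w}

theorem measurableSet_addressFiber (κ : Fin s → ℕ) (w : ∀ j, Fin (κ j) → Fin b) :
    MeasurableSet (addressFiber T κ w) := by
  have : Measurable fun x : Pt s d => fun j (l : Fin (κ j)) => blockAddress T x j l :=
    measurable_pi_lambda _ fun j => measurable_pi_lambda _ fun l =>
      (measurable_pi_apply (l : ℕ)).comp
        ((measurable_pi_apply j).comp (measurable_blockAddress T))
  exact this (measurableSet_singleton w)

theorem restrict_addressFiber (κ : Fin s → ℕ) (w : ∀ j, Fin (κ j) → Fin b) :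
    (volume.restrict (Set.univ.pi X)).restrict (addressFiber T κ w)
      = volume.restrict (Set.univ.pi fun j => (T j).cell (κ j) (w j)) := by
  rw [Measure.restrict_restrict (measurableSet_addressFiber T κ w)]
  have : addressFiber T κ w ∩ Set.univ.pi X = Set.univ.pi fun j =>
      {x | (fun l : Fin (κ j) => (T j).address x l) = w j} ∩ X j := by
    ext x
    simp only [addressFiber, blockAddress, Set.mem_inter_iff, Set.mem_ofPred_eq, Set.mem_univ_pi,
      forall_and, funext_iff]
  rw [this, volume_pi, Measure.restrict_pi_pi, Measure.restrict_pi_pi]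
  congr 1
  funext j
  exact (T j).restrict_word_eq (κ j) (w j)

theorem integral_eq_sum_addressFiber (κ : Fin s → ℕ) {g : Pt s d → ℝ}
    (hg : ∀ w, IntegrableOn g (addressFiber T κ w) (volume.restrict (Set.univ.pi X))) :
    ∫ x in Set.univ.pi X, g x
      = ∑ w, ∫ x in addressFiber T κ w, g x ∂(volume.restrict (Set.univ.pi X)) := by
  rw [← integral_iUnion_fintype (measurableSet_addressFiber T κ) _ hg]
  · have : ⋃ w, addressFiber T κ w = Set.univ :=
      Set.eq_univ_of_forall fun x => Set.mem_iUnion.2 ⟨_, rfl⟩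
    rw [this, Measure.restrict_univ]
  · intro w w' hw
    refine Set.disjoint_left.2 fun x hx hx' => hw ?_
    exact (show _ = w from hx).symm.trans hx'

/-- `cellMean` is the conditional expectation of `g` given the first κ_j digits of every block. On
each of the finitely many address fibers `h` is constant, and the fiber agrees almost everywhere
with a product of cells. -/
theorem integral_mul_blockAddress (hb : b ≠ 0) (hvol : ∀ j, volume (X j) = 1) {g : Pt s d → ℝ}
    (hg : IntegrableOn g (Set.univ.pi X)) (κ : Fin s → ℕ) {h : (Fin s → ℕ → Fin b) → ℝ}
    (hh : ∀ u u' : Fin s → ℕ → Fin b, (∀ j, ∀ l < κ j, u j l = u' j l) → h u = h u') :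
    ∫ x in Set.univ.pi X, g x * h (blockAddress T x)
      = ∫ x in Set.univ.pi X, cellMean T g κ (blockAddress T x) * h (blockAddress T x) := by
  have hfin : ∀ j, volume (X j) ≠ ⊤ := fun j => by simp [hvol]
  have : IsFiniteMeasure (volume.restrict (Set.univ.pi X)) := by
    refine ⟨?_⟩
    simp [volume_pi_pi, hvol]
  have hfib : ∀ w, ∀ x ∈ addressFiber T κ w, ∀ y ∈ addressFiber T κ w, ∀ j, ∀ l < κ j,
      blockAddress T x j l = blockAddress T y j l := by
    intro w x hx y hy j l hl
    have := (show _ = w from hx).trans (show _ = w from hy).symm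
    exact congrFun (congrFun this j) ⟨l, hl⟩
  have hconst : ∀ w, ∀ x₀ ∈ addressFiber T κ w,
      Set.EqOn (fun x => g x * h (blockAddress T x)) (fun x => g x * h (blockAddress T x₀))
        (addressFiber T κ w) ∧
      Set.EqOn (fun x => cellMean T g κ (blockAddress T x) * h (blockAddress T x))
        (fun _ => cellMean T g κ (blockAddress T x₀) * h (blockAddress T x₀))
        (addressFiber T κ w) := by
    intro w x₀ hx₀
    refine ⟨fun x hx => ?_, fun x hx => ?_⟩
    · simp only [hh _ _ (hfib w x hx x₀ hx₀)]
    · simp only [hh _ _ (hfib w x hx x₀ hx₀), cellMean_congr T g (hfib w x hx x₀ hx₀)]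
  rw [integral_eq_sum_addressFiber T κ, integral_eq_sum_addressFiber T κ]
  · refine Finset.sum_congr rfl fun w _ => ?_
    rcases (addressFiber T κ w).eq_empty_or_nonempty with he | ⟨x₀, hx₀⟩
    · simp [he]
    · have hbox : (Set.univ.pi fun j => (T j).cell (κ j) (w j))
          = cellBox T κ (blockAddress T x₀) := by
        rw [← show _ = w from hx₀]
        rfl
      have hm := measurableSet_addressFiber T κ w
      rw [setIntegral_congr_fun hm (hconst w x₀ hx₀).1,
        setIntegral_congr_fun hm (hconst w x₀ hx₀).2, restrict_addressFiber, hbox,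
        integral_mul_const, setIntegral_cellBox T hb hvol, setIntegral_const, smul_eq_mul]
      ring
  · intro w
    rcases (addressFiber T κ w).eq_empty_or_nonempty with he | ⟨x₀, hx₀⟩
    · simp [he]
    · exact (integrableOn_const (measure_ne_top _ _)).congr_fun (hconst w x₀ hx₀).2.symm
        (measurableSet_addressFiber T κ w)
  · intro w
    rcases (addressFiber T κ w).eq_empty_or_nonempty with he | ⟨x₀, hx₀⟩
    · simp [he]
    · exact IntegrableOn.congr_fun (hg.integrable.mul_const _).integrableOn
        (hconst w x₀ hx₀).1.symm (measurableSet_addressFiber T κ w)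

end

/-! ### Contrasts -/

/-- The component of `g` of order `{1, …, s}` and level `κ`, as a function of the digits. -/
def contrast (g : Pt s d → ℝ) (κ : Fin s → ℕ) (u : Fin s → ℕ → Fin b) : ℝ :=
  ∑ v : Finset (Fin s),
    (-1) ^ v.card * cellMean T g (fun j => if j ∈ v then κ j else κ j + 1) u

theorem contrast_congr (g : Pt s d → ℝ) {κ : Fin s → ℕ} {u u' : Fin s → ℕ → Fin b}
    (h : ∀ j, ∀ l ≤ κ j, u j l = u' j l) : contrast T g κ u = contrast T g κ u' := by
  unfold contrast
  refine Finset.sum_congr rfl fun v _ => ?_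
  rw [cellMean_congr T g fun j l hl => h j l ?_]
  split_ifs at hl <;> omega

theorem sum_neg_one_pow_card_mul_eq_zero {A : Finset (Fin s) → ℝ} {j : Fin s}
    (hA : ∀ v, j ∉ v → A (insert j v) = A v) : ∑ v : Finset (Fin s), (-1) ^ v.card * A v = 0 := by
  have h : (Finset.univ : Finset (Finset (Fin s)))
      = (insert j (Finset.univ.erase j)).powerset := by
    rw [Finset.insert_erase (Finset.mem_univ j), Finset.powerset_univ]
  rw [h, Finset.sum_powerset_insert (Finset.notMem_erase j _), ← Finset.sum_add_distrib]
  refine Finset.sum_eq_zero fun v hv => ?_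
  have hj : j ∉ v := fun hj => Finset.notMem_erase j _ (Finset.mem_powerset.1 hv hj)
  rw [Finset.card_insert_of_notMem hj, hA v hj]
  ring

/-- The measures on the two sides agree on measurable rectangles, which form a generating π-system.
-/
theorem sum_integral_pi_update {ι : Type*} [Fintype ι] {E : Fin s → Type*}
    [∀ j, MeasurableSpace (E j)] (μ : ∀ j, Measure (E j)) [∀ j, IsProbabilityMeasure (μ j)]
    (j : Fin s) (ν : ι → Measure (E j)) [∀ c, IsProbabilityMeasure (ν c)] {r : ENNReal}
    (h : ∑ c, ν c = r • μ j) {g : (∀ j, E j) → ℝ}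
    (hg : ∀ c, Integrable g (Measure.pi (Function.update μ j (ν c)))) :
    ∑ c, ∫ x, g x ∂(Measure.pi (Function.update μ j (ν c)))
      = r.toReal * ∫ x, g x ∂(Measure.pi μ) := by
  have hprob : ∀ c l, IsProbabilityMeasure (Function.update μ j (ν c) l) := by
    intro c l
    rcases eq_or_ne l j with rfl | hl
    · simpa using inferInstanceAs (IsProbabilityMeasure (ν c))
    · simpa [hl] using inferInstanceAs (IsProbabilityMeasure (μ l))
  have hfin : IsFiniteMeasure (∑ c, Measure.pi (Function.update μ j (ν c))) := by
    infer_instance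
  have key : ∑ c, Measure.pi (Function.update μ j (ν c)) = r • Measure.pi μ := by
    -- Comparing total masses in `h` shows that r is finite, as uniqueness of finite measures
    -- requires.
    have hr : r = Fintype.card ι := by
      have := congrArg (fun m => m Set.univ) h
      simpa using this.symm
    have : IsFiniteMeasure (r • Measure.pi μ) := by
      refine ⟨?_⟩
      simp [hr]
    refine ext_of_generate_finite _ generateFrom_pi.symm isPiSystem_pi ?_ ?_
    · rintro _ ⟨t, ht, rfl⟩
      have hpi : ∀ c, Measure.pi (Function.update μ j (ν c)) (Set.univ.pi t)
          = ν c (t j) * ∏ l ∈ Finset.univ.erase j, μ l (t l) := by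
        intro c
        rw [Measure.pi_pi, ← Finset.mul_prod_erase _ _ (Finset.mem_univ j)]
        congr 1
        · simp
        · refine Finset.prod_congr rfl fun l hl => ?_
          rw [Function.update_of_ne (Finset.ne_of_mem_erase hl)]
      have h1 := congrArg (fun m => m (t j)) h
      simp only [Measure.coe_finsetSum, Finset.sum_apply, Measure.smul_apply, smul_eq_mul] at h1 ⊢
      simp only [hpi]
      rw [← Finset.sum_mul, h1, Measure.pi_pi, ← Finset.mul_prod_erase _ _ (Finset.mem_univ j),
        mul_assoc]
    · simp [hr]
  rw [← integral_finsetSum_measure fun c _ => hg c, key, integral_smul_measure, smul_eq_mul]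

/-- The subsets v and v ∪ {j} cancel. The means over the b children in block j sum to b times the
mean over the parent, and the mean over the parent does not see the digit that is summed over. -/
theorem sum_contrast_update (hb : b ≠ 0) (hvol : ∀ j, volume (X j) = 1) {g : Pt s d → ℝ}
    (hg : IntegrableOn g (Set.univ.pi X)) (κ : Fin s → ℕ) (u : Fin s → ℕ → Fin b) (j : Fin s) :
    ∑ c, contrast T g κ (Function.update u j (Function.update (u j) (κ j) c)) = 0 := by
  unfold contrast
  rw [Finset.sum_comm]
  simp only [← Finset.mul_sum]
  refine sum_neg_one_pow_card_mul_eq_zero (j := j) fun v hv => ?_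
  set κ' : Fin s → ℕ := fun l => if l ∈ insert j v then κ l else κ l + 1 with hκ'
  have h1 : ∀ c, cellMean T g κ' (Function.update u j (Function.update (u j) (κ j) c))
      = cellMean T g κ' u := by
    intro c
    refine cellMean_congr T g fun l n hn => ?_
    rcases eq_or_ne l j with rfl | hl
    · have : n ≠ κ l := by
        simp only [hκ', Finset.mem_insert_self, if_true] at hn
        exact hn.ne
      simp [this]
    · simp [hl]
  have : ∀ l, IsProbabilityMeasure (volume[|(T l).cellAt (u l) (κ' l)]) :=
    fun l => (T l).isProbabilityMeasure_cond hb (hvol l) (κ' l) fun n => u l n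
  have : ∀ c, IsProbabilityMeasure
      (volume[|(T j).cellAt (Function.update (u j) (κ j) c) (κ j + 1)]) :=
    fun c => (T j).isProbabilityMeasure_cond hb (hvol j) _ _
  have h2 : ∀ c, cellPi T (fun l => if l ∈ v then κ l else κ l + 1)
      (Function.update u j (Function.update (u j) (κ j) c))
      = Measure.pi (Function.update (fun l => volume[|(T l).cellAt (u l) (κ' l)]) j
        (volume[|(T j).cellAt (Function.update (u j) (κ j) c) (κ j + 1)])) := by
    intro c
    unfold cellPi
    congr 1
    funext l
    rcases eq_or_ne l j with rfl | hl
    · simp [hv]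
    · simp [hl, hκ']
  have h3 : ∑ c, volume[|(T j).cellAt (Function.update (u j) (κ j) c) (κ j + 1)]
      = (b : ENNReal) • volume[|(T j).cellAt (u j) (κ' j)] := by
    have : κ' j = κ j := by simp [hκ']
    rw [this]
    exact (T j).sum_cond_cellAt_update hb (u j) (κ j)
  have h4 := sum_integral_pi_update (fun l => volume[|(T l).cellAt (u l) (κ' l)]) j
    (fun c => volume[|(T j).cellAt (Function.update (u j) (κ j) c) (κ j + 1)]) h3 (g := g)
    (fun c => by
      rw [← h2]
      exact integrable_cellPi T hb hvol hg _ _)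
  simp only [h1, Finset.sum_const, Finset.card_univ, Fintype.card_fin, nsmul_eq_mul]
  simp only [← h2] at h4
  rw [ENNReal.toReal_natCast] at h4
  exact h4.symm

end GeomNet
end

noncomputable section
namespace GeomNet

/-! ### Contrasts of smooth functions -/

theorem integrable_id_cond_cell {d b : ℕ} {S : Set (Block d)} (T : RecursiveSplit b S)
    (hb : b ≠ 0) (hS : volume S = 1) (hbd : Bornology.IsBounded S) (u : ℕ → Fin b) (k : ℕ) :
    Integrable (fun x => x) (volume[|T.cellAt u k]) := by
  have : IsProbabilityMeasure (volume[|T.cellAt u k]) :=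
    T.isProbabilityMeasure_cond hb hS k fun l => u l
  obtain ⟨R, hR⟩ := hbd.exists_norm_le
  refine Integrable.of_bound measurable_id.aestronglyMeasurable R ?_
  filter_upwards [ae_cond_mem (T.measurableSet_cell k fun l => u l)] with x hx
  exact hR x (T.cell_subset _ _ hx)

theorem integral_coord_cond_cell {d b : ℕ} {S : Set (Block d)} (T : RecursiveSplit b S)
    (hb : b ≠ 0) (hS : volume S = 1) (hbd : Bornology.IsBounded S) (u : ℕ → Fin b) (k : ℕ)
    (i : Fin d) : ∫ x, x i ∂(volume[|T.cellAt u k]) = center (T.cellAt u k) i := by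
  have h := (EuclideanSpace.proj (𝕜 := ℝ) i : Block d →L[ℝ] ℝ).integral_comp_comm
    (integrable_id_cond_cell T hb hS hbd u k)
  have h2 : center (T.cellAt u k) = ∫ x, x ∂(volume[|T.cellAt u k]) := by
    rw [center, average, Measure.restrict_apply_univ]
    rfl
  rw [h2]
  exact h

variable {s d b : ℕ} {X : Fin s → Set (Block d)} (T : ∀ j, RecursiveSplit b (X j))

/-- All 2^s cell means are realized on one probability space `ρ`, which carries for each block an
independent pair of uniform points of the narrow and the wide cell. The contrast becomes the
expectation of a mixed difference, estimated pointwise by `abs_mixedDiff_univ_sub_le`. By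
independence the expectation of the main term factors into differences of centers. -/
theorem abs_contrast_sub_le (hb : b ≠ 0) (hvol : ∀ j, volume (X j) = 1)
    (hbd : ∀ j, Bornology.IsBounded (X j)) {c : Pt s d}
    (hc : ∀ j, ∀ z ∈ X j, ∀ p : Block d, (∀ i, p i ∈ Set.uIcc (c j i) (z i)) → p ∈ X j)
    {F : Finset (Fin s) → (Fin s → Fin d) → Pt s d → ℝ}
    (hF : ∀ v j, j ∉ v → ∀ η i, ∀ x ∈ Set.univ.pi X,
      HasDerivWithinAt (fun t : ℝ => F v η (shift x j i t))
        (F (insert j v) (Function.update η j i) x) {t : ℝ | shift x j i t ∈ Set.univ.pi X} 0)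
    {f : Pt s d → ℝ} (hf : IntegrableOn f (Set.univ.pi X)) {η₀ : Fin s → Fin d}
    (hf₀ : ∀ x ∈ Set.univ.pi X, F ∅ η₀ x = f x)
    {κ : Fin s → ℕ} {u : Fin s → ℕ → Fin b} {G : (Fin s → Fin d) → ℝ} {ε : ℝ} (hε : 0 ≤ ε)
    {L : Fin s → ℝ}
    (hG : ∀ y ∈ cellBox T κ u, ∀ z ∈ cellBox T κ u, ∀ x ∈ Set.univ.pi X,
      (∀ l i, x l i ∈ Set.uIcc (y l i) (z l i)) → ∀ η, |F Finset.univ η x - G η| ≤ ε)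
    (hL : ∀ j, ∀ y ∈ (T j).cellAt (u j) (κ j), ∀ z ∈ (T j).cellAt (u j) (κ j),
      ∑ i, |y i - z i| ≤ L j) :
    |contrast T f κ u - ∑ η : Fin s → Fin d, G η * ∏ j,
        (center ((T j).cellAt (u j) (κ j + 1)) - center ((T j).cellAt (u j) (κ j))) (η j)|
      ≤ ε * ∏ j, L j := by
  set N : ∀ _ : Fin s, Measure (Block d) := fun j => volume[|(T j).cellAt (u j) (κ j + 1)] with hN
  set W : ∀ _ : Fin s, Measure (Block d) := fun j => volume[|(T j).cellAt (u j) (κ j)] with hW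
  have hNp : ∀ j, IsProbabilityMeasure (N j) := fun j =>
    (T j).isProbabilityMeasure_cond hb (hvol j) (κ j + 1) fun l => u j l
  have hWp : ∀ j, IsProbabilityMeasure (W j) := fun j =>
    (T j).isProbabilityMeasure_cond hb (hvol j) (κ j) fun l => u j l
  set ρ : Measure (Fin s → Block d × Block d) := Measure.pi fun j => (N j).prod (W j) with hρ
  have hmp : ∀ v : Finset (Fin s), MeasurePreserving
      (fun (p : Fin s → Block d × Block d) j => if j ∈ v then (p j).2 else (p j).1) ρ
      (cellPi T (fun j => if j ∈ v then κ j else κ j + 1) u) := by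
    intro v
    have hp : ∀ j, IsProbabilityMeasure
        (volume[|(T j).cellAt (u j) (if j ∈ v then κ j else κ j + 1)]) := fun j =>
      (T j).isProbabilityMeasure_cond hb (hvol j) _ fun l => u j l
    refine measurePreserving_pi (f := fun j (p : Block d × Block d) => if j ∈ v then p.2 else p.1)
      (fun j => (N j).prod (W j)) _ fun j => ?_
    by_cases hj : j ∈ v
    · simpa only [hj, if_true] using measurePreserving_snd (μ := N j) (ν := W j)
    · simpa only [hj, if_false] using measurePreserving_fst (μ := N j) (ν := W j)
  have hfi := fun v : Finset (Fin s) =>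
    integrable_cellPi T hb hvol hf (fun j => if j ∈ v then κ j else κ j + 1) u
  have hfρ : ∀ v : Finset (Fin s), Integrable
      (fun p : Fin s → Block d × Block d => f fun j => if j ∈ v then (p j).2 else (p j).1) ρ :=
    fun v => (hmp v).integrable_comp_of_integrable (hfi v)
  have h1 : contrast T f κ u = ∫ p, ∑ v : Finset (Fin s),
      (-1) ^ v.card * f (fun j => if j ∈ v then (p j).2 else (p j).1) ∂ρ := by
    rw [integral_finsetSum _ fun v _ => (hfρ v).const_mul _]
    refine Finset.sum_congr rfl fun v _ => ?_
    rw [integral_const_mul, cellMean, ← (hmp v).map_eq, integral_map (hmp v).aemeasurable]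
    rw [(hmp v).map_eq]
    exact (hfi v).aestronglyMeasurable
  have hcoord : ∀ j i, Integrable (fun p : Block d × Block d => p.1 i - p.2 i)
      ((N j).prod (W j)) := by
    intro j i
    have hi := fun k => (EuclideanSpace.proj (𝕜 := ℝ) i : Block d →L[ℝ] ℝ).integrable_comp
      (integrable_id_cond_cell (T j) hb (hvol j) (hbd j) (u j) k)
    exact ((hi (κ j + 1)).comp_fst (W j)).sub ((hi (κ j)).comp_snd (N j))
  have hprod : ∀ η : Fin s → Fin d, Integrable
      (fun p : Fin s → Block d × Block d => ∏ j, ((p j).1 (η j) - (p j).2 (η j))) ρ := fun η =>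
    Integrable.fintype_prod_dep (f := fun j (p : Block d × Block d) => p.1 (η j) - p.2 (η j))
      fun j => hcoord j (η j)
  have h2 : ∑ η : Fin s → Fin d, G η * ∏ j,
        (center ((T j).cellAt (u j) (κ j + 1)) - center ((T j).cellAt (u j) (κ j))) (η j)
      = ∫ p, ∑ η : Fin s → Fin d, G η * ∏ j, ((p j).1 (η j) - (p j).2 (η j)) ∂ρ := by
    rw [integral_finsetSum _ fun η _ => (hprod η).const_mul _]
    refine Finset.sum_congr rfl fun η _ => ?_
    rw [integral_const_mul, hρ, integral_fintype_prod_eq_prod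
      (fun j (p : Block d × Block d) => p.1 (η j) - p.2 (η j))]
    congr 1
    refine Finset.prod_congr rfl fun j _ => ?_
    have hi := fun k => (EuclideanSpace.proj (𝕜 := ℝ) (η j) : Block d →L[ℝ] ℝ).integrable_comp
      (integrable_id_cond_cell (T j) hb (hvol j) (hbd j) (u j) k)
    have h5 : ∫ p : Block d × Block d, p.1 (η j) - p.2 (η j) ∂((N j).prod (W j))
        = ∫ p : Block d × Block d, p.1 (η j) ∂((N j).prod (W j))
          - ∫ p : Block d × Block d, p.2 (η j) ∂((N j).prod (W j)) :=
      integral_sub ((hi (κ j + 1)).comp_fst (W j)) ((hi (κ j)).comp_snd (N j))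
    rw [h5, integral_fun_fst (fun y : Block d => y (η j)),
      integral_fun_snd (fun y : Block d => y (η j)), hN, hW]
    simp only [integral_coord_cond_cell (T j) hb (hvol j) (hbd j)]
    simp
  have h3 : Integrable (fun p : Fin s → Block d × Block d => ∑ η : Fin s → Fin d,
      G η * ∏ j, ((p j).1 (η j) - (p j).2 (η j))) ρ :=
    integrable_finsetSum _ fun η _ => (hprod η).const_mul _
  have h4 : Integrable (fun p : Fin s → Block d × Block d => ∑ v : Finset (Fin s),
      (-1) ^ v.card * f (fun j => if j ∈ v then (p j).2 else (p j).1)) ρ :=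
    integrable_finsetSum _ fun v _ => (hfρ v).const_mul _
  rw [h1, h2, ← integral_sub h4 h3, ← Real.norm_eq_abs]
  have hmem : ∀ᵐ p ∂ρ, ∀ j, (p j).1 ∈ (T j).cellAt (u j) (κ j + 1) ∧
      (p j).2 ∈ (T j).cellAt (u j) (κ j) := by
    refine eventually_all.2 fun j => ?_
    have h5 : ∀ᵐ q ∂((N j).prod (W j)), q.1 ∈ (T j).cellAt (u j) (κ j + 1) :=
      (measurePreserving_fst (μ := N j) (ν := W j)).quasiMeasurePreserving.ae
        (ae_cond_mem ((T j).measurableSet_cell _ _))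
    have h6 : ∀ᵐ q ∂((N j).prod (W j)), q.2 ∈ (T j).cellAt (u j) (κ j) :=
      (measurePreserving_snd (μ := N j) (ν := W j)).quasiMeasurePreserving.ae
        (ae_cond_mem ((T j).measurableSet_cell _ _))
    exact (Measure.quasiMeasurePreserving_eval (fun j => (N j).prod (W j)) j).ae (h5.and h6)
  refine (norm_integral_le_of_norm_le_const (C := ε * ∏ j, L j) ?_).trans (by simp)
  filter_upwards [hmem] with p hp
  have hp1 : ∀ j, (p j).1 ∈ (T j).cellAt (u j) (κ j) := fun j =>
    (T j).cellAt_antitone (u j) (Nat.le_succ _) (hp j).1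
  have hX1 : ∀ j, (p j).1 ∈ X j := fun j => (T j).cell_subset _ _ (hp1 j)
  have hX2 : ∀ j, (p j).2 ∈ X j := fun j => (T j).cell_subset _ _ (hp j).2
  have h7 := abs_mixedDiff_univ_sub_le hc hF (y := fun j => (p j).1) (z := fun j => (p j).2)
    hX1 hX2 (G := G) (ε := ε)
    (fun x hx hx' η => hG _ (fun j _ => hp1 j) _ (fun j _ => (hp j).2) x hx hx' η) η₀
  have h8 : ∀ v : Finset (Fin s), F ∅ η₀ (fun l => if l ∈ v then (p l).2 else (p l).1)
      = f (fun l => if l ∈ v then (p l).2 else (p l).1) := by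
    intro v
    refine hf₀ _ fun l _ => ?_
    simp only
    split_ifs
    · exact hX2 l
    · exact hX1 l
  simp only [h8] at h7
  rw [Real.norm_eq_abs]
  refine h7.trans (mul_le_mul_of_nonneg_left ?_ hε)
  exact Finset.prod_le_prod (fun j _ => Finset.sum_nonneg fun i _ => abs_nonneg _)
    fun j _ => hL j _ (hp1 j) _ (hp j).2

end GeomNet
end

noncomputable section
namespace GeomNet

/-! ### Regions and integrands -/

theorem SobolExtensible.exists_anchor {s d : ℕ} {X : Fin s → Set (Block d)}
    (hX : SobolExtensible (Set.univ.pi X)) :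
    ∃ c : Pt s d, ∀ j, ∀ z ∈ X j, ∀ p : Block d,
      (∀ i, p i ∈ Set.uIcc (c j i) (z i)) → p ∈ X j := by
  obtain ⟨c, hcX, hc⟩ := hX
  refine ⟨c, fun j z hz p hp => ?_⟩
  have h := hc (Function.update c j z) (fun l _ => by
    rcases eq_or_ne l j with rfl | hl
    · simpa using hz
    · simpa [hl] using hcX l trivial) (Function.update c j p) (fun l i => by
    rcases eq_or_ne l j with rfl | hl
    · simpa using hp i
    · simp [hl]) j trivial
  simpa using h

/-- The partial derivatives of a family of gradients, with the directions of all the blocks given,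
also of those which are not differentiated. -/
def partials {s d : ℕ} (D : GradFamily s d) (v : Finset (Fin s)) (η : Fin s → Fin d)
    (x : Pt s d) : ℝ := D v x fun l => η l

theorem hasDerivWithinAt_partials {s d : ℕ} {Y : Set (Pt s d)} {f : Pt s d → ℝ}
    {D : GradFamily s d} (hD : IsMixedGradient Y f D) (v : Finset (Fin s)) (j : Fin s) (hj : j ∉ v)
    (η : Fin s → Fin d) (i : Fin d) (x : Pt s d) (hx : x ∈ Y) :
    HasDerivWithinAt (fun t : ℝ => partials D v η (shift x j i t))
      (partials D (insert j v) (Function.update η j i) x) {t : ℝ | shift x j i t ∈ Y} 0 := by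
  have h := hD.insert v j hj (fun l => Function.update η j i l) x hx
  simp only [Function.update_self] at h
  have h2 : (fun l : {l // l ∈ v} => Function.update η j i l) = fun l : {l // l ∈ v} => η l := by
    funext l
    exact Function.update_of_ne (ne_of_mem_of_not_mem l.2 hj) _ _
  rw [h2] at h
  exact h

theorem abs_partials_sub_le {s d : ℕ} {D : GradFamily s d} (v : Finset (Fin s))
    (η : Fin s → Fin d) (x y : Pt s d) :
    |partials D v η x - partials D v η y| ≤ ‖D v x - D v y‖ := by
  have := PiLp.norm_apply_le (D v x - D v y) fun l => η l
  simpa [partials] using this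

/-- The Bochner integral of a non-integrable function is 0 by convention, so a nonzero integral
forces integrability. -/
theorem integrableOn_partials {s d : ℕ} {Y : Set (Pt s d)} {D : GradFamily s d}
    {v : Finset (Fin s)} (h : 0 < ‖∫ x in Y, D v x‖ ^ 2) (η : Fin s → Fin d) :
    IntegrableOn (partials D v η) Y := by
  have hi : IntegrableOn (D v) Y := by
    by_contra hi
    rw [integral_undef hi] at h
    simp at h
  exact (EuclideanSpace.proj (𝕜 := ℝ) (fun l : {j // j ∈ v} => η l) :
    EuclideanSpace ℝ ({j // j ∈ v} → Fin d) →L[ℝ] ℝ).integrable_comp hi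

theorem sum_integral_partials_sq_pos {s d : ℕ} {Y : Set (Pt s d)} {D : GradFamily s d}
    (h : 0 < ‖∫ x in Y, D Finset.univ x‖ ^ 2) :
    0 < ∑ η : Fin s → Fin d, (∫ x in Y, partials D Finset.univ η x) ^ 2 := by
  have hi : IntegrableOn (D Finset.univ) Y := by
    by_contra hi
    rw [integral_undef hi] at h
    simp at h
  have h1 : ∃ η', (∫ x in Y, D Finset.univ x) η' ≠ 0 := by
    by_contra! hz
    have : ∫ x in Y, D Finset.univ x = 0 := by
      ext η'
      simpa using hz η'
    rw [this] at h
    simp at h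
  obtain ⟨η', hη'⟩ := h1
  have h2 := (EuclideanSpace.proj (𝕜 := ℝ) η' :
    EuclideanSpace ℝ ({j // j ∈ (Finset.univ : Finset (Fin s))} → Fin d) →L[ℝ] ℝ).integral_comp_comm
    hi
  have h3 : ∫ x in Y, partials D Finset.univ (fun j => η' ⟨j, Finset.mem_univ j⟩) x
      = (∫ x in Y, D Finset.univ x) η' := h2
  refine Finset.sum_pos' (fun _ _ => sq_nonneg _)
    ⟨fun j => η' ⟨j, Finset.mem_univ j⟩, Finset.mem_univ _, ?_⟩
  rw [h3]
  positivity

variable {s d b : ℕ} {X : Fin s → Set (Block d)} (T : ∀ j, RecursiveSplit b (X j))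

theorem exists_common_diam (hT : ∀ j, (T j).Spherical) :
    ∃ C : ℝ, 0 ≤ C ∧ ∀ j k u, ∀ x ∈ (T j).cellAt u k, ∀ y ∈ (T j).cellAt u k,
      dist x y ≤ C * (b : ℝ) ^ (-((k : ℝ) / (d : ℝ))) := by
  choose C hC hdiam using hT
  refine ⟨∑ j, C j, Finset.sum_nonneg fun j _ => (hC j).le, fun j k u x hx y hy => ?_⟩
  refine (hdiam j k _ x hx y hy).trans (mul_le_mul_of_nonneg_right ?_ (by positivity))
  exact Finset.single_le_sum (f := C) (fun j _ => (hC j).le) (Finset.mem_univ j)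

theorem RecursiveSplit.Spherical.isBounded {S : Set (Block d)} {T : RecursiveSplit b S}
    (hT : T.Spherical) : Bornology.IsBounded S := by
  obtain ⟨C, -, h⟩ := hT
  refine Metric.isBounded_iff.2 ⟨C * (b : ℝ) ^ (-(((0 : ℕ) : ℝ) / (d : ℝ))), fun x hx y hy => ?_⟩
  rw [← T.cell_zero Fin.elim0] at hx hy
  exact h 0 _ x hx y hy

theorem norm_sub_le_of_mem_uIcc {x y z : Block d} (h : ∀ i, x i ∈ Set.uIcc (y i) (z i)) :
    ‖x - y‖ ≤ ‖z - y‖ := by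
  rw [EuclideanSpace.norm_eq, EuclideanSpace.norm_eq]
  refine Real.sqrt_le_sqrt (Finset.sum_le_sum fun i _ => ?_)
  simp only [PiLp.sub_apply, Real.norm_eq_abs]
  have := Set.abs_sub_left_of_mem_uIcc (h i)
  gcongr

theorem exists_level_euclDist_le (hd : 1 ≤ d) (hb : 2 ≤ b) (hT : ∀ j, (T j).Spherical)
    {δ : ℝ} (hδ : 0 < δ) :
    ∃ k₀ : ℕ, ∀ κ : Fin s → ℕ, (∀ j, k₀ ≤ κ j) → ∀ u, ∀ y ∈ cellBox T κ u, ∀ z ∈ cellBox T κ u,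
      ∀ w ∈ cellBox T κ u, ∀ x : Pt s d, (∀ l i, x l i ∈ Set.uIcc (y l i) (z l i)) →
      euclDist x w ≤ δ := by
  obtain ⟨C, hC, hdiam⟩ := exists_common_diam T hT
  -- Cells need not be convex, so `x` may lie outside them. Its distance to `w` is estimated through
  -- `y`, which costs two diameters per block.
  have h1 : Tendsto (fun k : ℕ => Real.sqrt (∑ _j : Fin s,
      (2 * (C * (b : ℝ) ^ (-((k : ℝ) / (d : ℝ))))) ^ 2)) atTop (𝓝 0) := by
    have := (tendsto_finsetSum (Finset.univ : Finset (Fin s)) fun _ _ =>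
      ((tendsto_diam hd hb C).const_mul 2).pow 2).sqrt
    simpa using this
  obtain ⟨k₀, hk₀⟩ := (h1.eventually (ge_mem_nhds hδ)).exists
  refine ⟨k₀, fun κ hκ u y hy z hz w hw x hx => ?_⟩
  refine le_trans ?_ hk₀
  refine Real.sqrt_le_sqrt (Finset.sum_le_sum fun j _ => ?_)
  have hsub := fun (p : Pt s d) (hp : p ∈ cellBox T κ u) =>
    (T j).cellAt_antitone (u j) (hκ j) (hp j trivial)
  have h2 := hdiam j k₀ (u j) _ (hsub z hz) _ (hsub y hy)
  have h3 := hdiam j k₀ (u j) _ (hsub y hy) _ (hsub w hw)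
  rw [dist_eq_norm] at h2 h3
  have h4 := norm_sub_le_of_mem_uIcc (hx j)
  have h5 : ‖x j - w j‖ ≤ ‖x j - y j‖ + ‖y j - w j‖ := norm_sub_le_norm_sub_add_norm_sub _ _ _
  have h6 : ‖x j - w j‖ ≤ 2 * (C * (b : ℝ) ^ (-((k₀ : ℝ) / (d : ℝ)))) := by linarith
  gcongr

theorem abs_sub_cellMean_le (hb : b ≠ 0) (hvol : ∀ j, volume (X j) = 1) {g : Pt s d → ℝ}
    (hg : IntegrableOn g (Set.univ.pi X)) {κ : Fin s → ℕ} {u : Fin s → ℕ → Fin b} {r ε : ℝ}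
    (h : ∀ w ∈ cellBox T κ u, |r - g w| ≤ ε) : |r - cellMean T g κ u| ≤ ε := by
  have := isProbabilityMeasure_cellPi T hb hvol κ u
  have h1 : r - cellMean T g κ u = ∫ w, r - g w ∂(cellPi T κ u) := by
    rw [integral_sub (integrable_const _) (integrable_cellPi T hb hvol hg κ u)]
    simp [cellMean]
  rw [h1, ← Real.norm_eq_abs]
  refine (norm_integral_le_of_norm_le_const (C := ε) ?_).trans (by simp)
  rw [cellPi_eq_cond T hb hvol]
  filter_upwards [ae_cond_mem (measurableSet_cellBox T κ u)] with w hw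
  exact h w hw

theorem exists_level_abs_partials_sub_cellMean_le (hd : 1 ≤ d) (hb : 2 ≤ b)
    (hvol : ∀ j, volume (X j) = 1) (hT : ∀ j, (T j).Spherical) {D : GradFamily s d}
    (hD : HolderOn (Set.univ.pi X) D) {v : Finset (Fin s)}
    (hv : 0 < ‖∫ x in Set.univ.pi X, D v x‖ ^ 2) {ε : ℝ} (hε : 0 < ε) :
    ∃ k₀ : ℕ, ∀ κ : Fin s → ℕ, (∀ j, k₀ ≤ κ j) → ∀ u, ∀ y ∈ cellBox T κ u, ∀ z ∈ cellBox T κ u,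
      ∀ x ∈ Set.univ.pi X, (∀ l i, x l i ∈ Set.uIcc (y l i) (z l i)) → ∀ η,
      |partials D v η x - cellMean T (partials D v η) κ u| ≤ ε := by
  obtain ⟨B, β, hB, hβ, -, hH⟩ := hD
  obtain ⟨δ, hδ, hBδ⟩ : ∃ δ : ℝ, 0 < δ ∧ B * δ ^ β ≤ ε := by
    have h1 : Tendsto (fun δ : ℝ => B * δ ^ β) (𝓝[>] 0) (𝓝 0) := by
      have : Tendsto (fun δ : ℝ => B * δ ^ β) (𝓝 0) (𝓝 (B * (0 : ℝ) ^ β)) :=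
        ((Real.continuousAt_rpow_const 0 β (Or.inr hβ.le)).tendsto).const_mul B
      rw [Real.zero_rpow hβ.ne', mul_zero] at this
      exact this.mono_left nhdsWithin_le_nhds
    obtain ⟨δ, h2, h3⟩ := ((h1.eventually (ge_mem_nhds hε)).and self_mem_nhdsWithin).exists
    exact ⟨δ, h3, h2⟩
  obtain ⟨k₀, hk₀⟩ := exists_level_euclDist_le T hd hb hT hδ
  refine ⟨k₀, fun κ hκ u y hy z hz x hx hxyz η => ?_⟩
  refine abs_sub_cellMean_le T (by omega) hvol (integrableOn_partials hv η) fun w hw => ?_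
  refine (abs_partials_sub_le v η x w).trans
    ((hH v x hx w (cellBox_subset T κ u hw)).trans (le_trans ?_ hBδ))
  have := hk₀ κ hκ u y hy z hz w hw x hxyz
  have h0 : 0 ≤ euclDist x w := Real.sqrt_nonneg _
  gcongr

/-- Replace the digit of index `κ j` in the sequence `u j` by `c j`, for each `j`. -/
def setDigits (κ : Fin s → ℕ) (u : Fin s → ℕ → Fin b) (c : Fin s → Fin b) : Fin s → ℕ → Fin b :=
  fun j => Function.update (u j) (κ j) (c j)

theorem exists_level_le_sum_contrast_sq (hd : 1 ≤ d) (hb : 2 ≤ b)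
    (hvol : ∀ j, volume (X j) = 1) (hX : SobolExtensible (Set.univ.pi X))
    (hT : ∀ j, (T j).Spherical) {f : Pt s d → ℝ} {D : GradFamily s d}
    (hD : IsMixedGradient (Set.univ.pi X) f D) (hH : HolderOn (Set.univ.pi X) D)
    (hD₁ : 0 < ‖∫ x in Set.univ.pi X, D Finset.univ x‖ ^ 2)
    (hf : IntegrableOn f (Set.univ.pi X)) {c₀ : ℝ} (hc₀ : 0 < c₀)
    (hA : ∀ (j : Fin s) (k : ℕ) (w : Fin k → Fin b),
      c₀ * (b : ℝ) ^ (-(2 * (k : ℝ) / (d : ℝ))) ≤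
        minEigenvalue ((T j).centerMatrix_isHermitian k w)) {δ : ℝ} (hδ : 0 < δ) :
    ∃ k₀ : ℕ, ∀ κ : Fin s → ℕ, (∀ j, k₀ ≤ κ j) → ∀ u : Fin s → ℕ → Fin b,
      (∏ j, (b : ℝ) ^ (-(2 * (κ j : ℝ) / (d : ℝ)))) * (c₀ ^ s / 2 *
        ∑ η, cellMean T (partials D Finset.univ η) κ u ^ 2 - δ) ≤
      ∑ c : Fin s → Fin b, contrast T f κ (setDigits κ u c) ^ 2 := by
  obtain ⟨a, ha⟩ := hX.exists_anchor
  obtain ⟨C, hC, hdiam⟩ := exists_common_diam T hT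
  have hd0 : (0 : ℝ) < d := by exact_mod_cast hd
  have hb0 : (0 : ℝ) < b := by exact_mod_cast (by omega : 0 < b)
  -- For each of the b^s children the approximation error is at most ε (dC)^s R, with d coming from
  -- the passage to the ℓ¹ norm. The value of ε makes the sum of the squared errors at most δ R².
  -- The summand 1 keeps M positive when C = 0.
  set M : ℝ := (b : ℝ) ^ s * ((d * C) ^ s) ^ 2 + 1 with hM
  have hM0 : 0 < M := by positivity
  set ε : ℝ := Real.sqrt (δ / M) with hεdef
  have hε : 0 < ε := Real.sqrt_pos.2 (by positivity)
  have hεδ : (b : ℝ) ^ s * (ε * (d * C) ^ s) ^ 2 ≤ δ := by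
    have h1 : ε ^ 2 * M = δ := by
      rw [hεdef, Real.sq_sqrt (by positivity)]
      field_simp
    have h2 : 0 ≤ ε ^ 2 := sq_nonneg _
    calc (b : ℝ) ^ s * (ε * (d * C) ^ s) ^ 2 = ε ^ 2 * M - ε ^ 2 := by rw [hM]; ring
      _ ≤ δ := by linarith
  obtain ⟨k₀, hk₀⟩ := exists_level_abs_partials_sub_cellMean_le T hd hb hvol hT hH hD₁ hε
  refine ⟨k₀, fun κ hκ u => ?_⟩
  set G : (Fin s → Fin d) → ℝ := fun η => cellMean T (partials D Finset.univ η) κ u with hG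
  set R : ℝ := ∏ j, (b : ℝ) ^ (-((κ j : ℝ) / (d : ℝ))) with hR
  have hR2 : ∏ j, (b : ℝ) ^ (-(2 * (κ j : ℝ) / (d : ℝ))) = R ^ 2 := by
    rw [hR, ← Finset.prod_pow]
    refine Finset.prod_congr rfl fun j _ => ?_
    rw [← Real.rpow_natCast, ← Real.rpow_mul hb0.le]
    congr 1
    push_cast
    ring
  set α : Fin s → Fin b → Fin d → ℝ := fun j c i =>
    (center ((T j).cell (κ j + 1) (Fin.snoc (α := fun _ => Fin b) (fun l : Fin (κ j) => u j l) c))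
      - center ((T j).cell (κ j) fun l : Fin (κ j) => u j l)) i with hα
  set t : (Fin s → Fin b) → ℝ := fun c => ∑ η, G η * ∏ j, α j (c j) (η j) with ht
  have hcongr : ∀ c : Fin s → Fin b, ∀ j, ∀ l < κ j, setDigits κ u c j l = u j l := by
    intro c j l hl
    simp [setDigits, hl.ne]
  have happrox : ∀ c, |contrast T f κ (setDigits κ u c) - t c| ≤ ε * (d * C) ^ s * R := by
    intro c
    have h := abs_contrast_sub_le T (by omega) hvol (fun j => (hT j).isBounded) ha
      (hasDerivWithinAt_partials hD) hf (η₀ := fun _ => ⟨0, by omega⟩)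
      (fun x hx => hD.empty x hx _) (κ := κ) (u := setDigits κ u c)
      (G := fun η => cellMean T (partials D Finset.univ η) κ (setDigits κ u c)) hε.le
      (L := fun j => d * (C * (b : ℝ) ^ (-((κ j : ℝ) / (d : ℝ)))))
      (hk₀ κ hκ (setDigits κ u c)) (fun j y hy z hz => by
        have h1 := hdiam j (κ j) _ y hy z hz
        rw [dist_eq_norm] at h1
        calc ∑ i, |y i - z i| ≤ ∑ _i : Fin d, C * (b : ℝ) ^ (-((κ j : ℝ) / (d : ℝ))) :=
              Finset.sum_le_sum fun i _ => (PiLp.norm_apply_le (y - z) i).trans h1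
          _ = _ := by simp)
    have h2 : ∏ j, (d : ℝ) * (C * (b : ℝ) ^ (-((κ j : ℝ) / (d : ℝ)))) = (d * C) ^ s * R := by
      simp only [← mul_assoc]
      rw [Finset.prod_mul_distrib, Finset.prod_const, Finset.card_univ, Fintype.card_fin]
    rw [h2, ← mul_assoc] at h
    refine le_trans (le_of_eq ?_) h
    congr 2
    refine Finset.sum_congr rfl fun η _ => ?_
    rw [cellMean_congr T _ (hcongr c)]
    congr 1
    refine Finset.prod_congr rfl fun j _ => ?_
    rw [(T j).cellAt_congr (hcongr c j), setDigits, (T j).cellAt_update_succ]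
    rfl
  have hten : c₀ ^ s * R ^ 2 * ∑ η, G η ^ 2 ≤ ∑ c, t c ^ 2 := by
    have h := prod_mul_sum_sq_le_sum_sq α
      (fun j => c₀ * (b : ℝ) ^ (-(2 * (κ j : ℝ) / (d : ℝ)))) (fun j => by positivity)
      (fun j g => (mul_le_mul_of_nonneg_right (hA j (κ j) fun l => u j l)
        (Finset.sum_nonneg fun i _ => sq_nonneg _)).trans
        ((T j).minEigenvalue_mul_le_sum (κ j) (fun l => u j l) g)) G
    rw [Finset.prod_mul_distrib, hR2, Finset.prod_const, Finset.card_univ, Fintype.card_fin] at h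
    exact h
  -- This uses t²/2 ≤ x² + (x - t)² for the contrast x; the two sides differ by (2x - t)²/2.
  have hsq : ∀ c, t c ^ 2 / 2 - (ε * (d * C) ^ s * R) ^ 2
      ≤ contrast T f κ (setDigits κ u c) ^ 2 := by
    intro c
    have h1 := sq_le_sq' (abs_le.1 (happrox c)).1 (abs_le.1 (happrox c)).2
    nlinarith [sq_nonneg (2 * contrast T f κ (setDigits κ u c) - t c)]
  have hsum := Finset.sum_le_sum fun (c : Fin s → Fin b) (_ : c ∈ Finset.univ) => hsq c
  rw [Finset.sum_sub_distrib, ← Finset.sum_div, Finset.sum_const, Finset.card_univ,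
    Fintype.card_pi, Finset.prod_const, Finset.card_univ, Fintype.card_fin, Fintype.card_fin,
    nsmul_eq_mul, Nat.cast_pow] at hsum
  rw [hR2]
  refine le_trans ?_ hsum
  have h3 : (b : ℝ) ^ s * (ε * (d * C) ^ s * R) ^ 2 ≤ δ * R ^ 2 := by
    calc (b : ℝ) ^ s * (ε * (d * C) ^ s * R) ^ 2
        = ((b : ℝ) ^ s * (ε * (d * C) ^ s) ^ 2) * R ^ 2 := by ring
      _ ≤ δ * R ^ 2 := mul_le_mul_of_nonneg_right hεδ (sq_nonneg _)
  have h4 : R ^ 2 * (c₀ ^ s / 2 * ∑ η, G η ^ 2 - δ)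
      = (c₀ ^ s * R ^ 2 * ∑ η, G η ^ 2) / 2 - δ * R ^ 2 := by ring
  rw [h4]
  linarith

end GeomNet
end

noncomputable section
namespace GeomNet

/-! ### The distribution of the scrambled digits -/

theorem _root_.MeasureTheory.MeasurePreserving.integral_comp_of_aestronglyMeasurable
    {α β : Type*} [MeasurableSpace α] [MeasurableSpace β] {μ : Measure α} {ν : Measure β}
    {φ : α → β} (h : MeasurePreserving φ μ ν) {g : β → ℝ} (hg : AEStronglyMeasurable g ν) :
    ∫ x, g (φ x) ∂μ = ∫ y, g y ∂ν := by
  rw [← h.map_eq] at hg ⊢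
  exact (integral_map h.measurable.aemeasurable hg).symm

instance instDiscreteMeasurableSpacePerm (b : ℕ) : DiscreteMeasurableSpace (Equiv.Perm (Fin b)) :=
  ⟨fun _ => trivial⟩

/-- The uniform distribution on the permutations of the digits. -/
def permMeasure (b : ℕ) : Measure (Equiv.Perm (Fin b)) :=
  ((b.factorial : ℕ) : ENNReal)⁻¹ • Measure.count

theorem permMeasure_singleton {b : ℕ} (σ : Equiv.Perm (Fin b)) :
    permMeasure b {σ} = ((b.factorial : ℕ) : ENNReal)⁻¹ := by
  simp [permMeasure]

instance isProbabilityMeasure_permMeasure (b : ℕ) : IsProbabilityMeasure (permMeasure b) := by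
  refine ⟨?_⟩
  have h : Measure.count (Set.univ : Set (Equiv.Perm (Fin b))) = ((b.factorial : ℕ) : ENNReal) := by
    rw [← Finset.coe_univ, Measure.count_apply_finset, Finset.card_univ, Fintype.card_perm,
      Fintype.card_fin]
  rw [permMeasure, Measure.smul_apply, h, smul_eq_mul, ENNReal.inv_mul_cancel]
  · exact_mod_cast b.factorial_ne_zero
  · exact ENNReal.natCast_ne_top _

theorem permMeasure_map_mul (b : ℕ) (τ : Equiv.Perm (Fin b)) :
    (permMeasure b).map (fun σ => τ * σ) = permMeasure b := by
  refine Measure.ext_of_singleton fun σ => ?_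
  rw [Measure.map_apply .of_discrete (measurableSet_singleton σ)]
  have : (fun σ => τ * σ) ⁻¹' {σ} = {τ⁻¹ * σ} := by
    ext ρ
    simp [eq_inv_mul_iff_mul_eq]
  rw [this, permMeasure_singleton, permMeasure_singleton]

/-- Left multiplication by a transposition preserves the uniform distribution and exchanges two
values of τ α, so all b values are equally likely. -/
theorem permMeasure_apply_eq {b : ℕ} (α c : Fin b) :
    permMeasure b {τ | τ α = c} = (b : ENNReal)⁻¹ := by
  have h1 : ∀ c', permMeasure b {τ | τ α = c'} = permMeasure b {τ | τ α = c} := by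
    intro c'
    conv_lhs => rw [← permMeasure_map_mul b (Equiv.swap c c')]
    rw [Measure.map_apply .of_discrete .of_discrete]
    congr 1
    ext τ
    simp only [Set.mem_preimage, Set.mem_ofPred_eq, Equiv.Perm.mul_apply]
    rw [← Equiv.eq_symm_apply, Equiv.symm_swap, Equiv.swap_apply_right]
  have h2 : ∑ c', permMeasure b {τ | τ α = c'} = 1 := by
    rw [← measure_univ (μ := permMeasure b), ← tsum_fintype (L := .unconditional _),
      ← measure_iUnion]
    · congr 1
      ext τ
      simp
    · intro c₁ c₂ hc
      refine Set.disjoint_left.2 fun τ h1 h2 => hc ?_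
      exact (show τ α = c₁ from h1).symm.trans h2
    · exact fun _ => .of_discrete
  simp only [h1, Finset.sum_const, Finset.card_univ, Fintype.card_fin, nsmul_eq_mul] at h2
  exact ENNReal.eq_inv_of_mul_eq_one_left (by rwa [mul_comm])

/-- The distribution of the permutations of a uniform scramble. -/
def scrambleMeasure (s b : ℕ) : Measure (PermIndex s b → Equiv.Perm (Fin b)) :=
  Measure.infinitePi fun _ => permMeasure b

instance isProbabilityMeasure_scrambleMeasure (s b : ℕ) :
    IsProbabilityMeasure (scrambleMeasure s b) := by
  unfold scrambleMeasure
  infer_instance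

/-- Reduces an arbitrary probability space to the product space of permutations, on which
translations are available. -/
theorem IsUniformScramble.measurePreserving {s b : ℕ} {Ω : Type v} [MeasurableSpace Ω]
    {P : Measure Ω} [IsProbabilityMeasure P] {π : PermIndex s b → Ω → Equiv.Perm (Fin b)}
    (h : IsUniformScramble P π) :
    MeasurePreserving (fun ω q => π q ω) P (scrambleMeasure s b) := by
  refine ⟨measurable_pi_lambda _ h.measurable, ?_⟩
  rw [h.indep.map_fun_eq_infinitePi_map h.measurable, scrambleMeasure]
  congr 1
  funext q
  refine Measure.ext_of_singleton fun σ => ?_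
  rw [Measure.map_apply (h.measurable q) (measurableSet_singleton σ), permMeasure_singleton]
  exact h.uniform q σ

theorem measurePreserving_mul_left {s b : ℕ} (τ : PermIndex s b → Equiv.Perm (Fin b)) :
    MeasurePreserving (fun σ => τ * σ) (scrambleMeasure s b) (scrambleMeasure s b) := by
  have hm : ∀ q, Measurable fun σ : Equiv.Perm (Fin b) => τ q * σ := fun q => .of_discrete
  refine ⟨measurable_pi_lambda _ fun q => (hm q).comp (measurable_pi_apply q), ?_⟩
  have := Measure.infinitePi_map_pi (μ := fun _ : PermIndex s b => permMeasure b) hm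
  simp only [permMeasure_map_mul] at this
  exact this

theorem measure_ext_of_digits {s b : ℕ} {μ ν : Measure (Fin s → ℕ → Fin b)} [IsProbabilityMeasure μ]
    [IsProbabilityMeasure ν]
    (h : ∀ K (w : Fin s → Fin K → Fin b), μ {u | (fun j (l : Fin K) => u j l) = w}
      = ν {u | (fun j (l : Fin K) => u j l) = w}) : μ = ν := by
  set r : ∀ K, (Fin s → ℕ → Fin b) → Fin s → Fin K → Fin b := fun K u j l => u j l with hr
  have hrm : ∀ K, Measurable (r K) := fun K => measurable_pi_lambda _ fun j =>
    measurable_pi_lambda _ fun l => (measurable_pi_apply (l : ℕ)).comp (measurable_pi_apply j)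
  refine ext_of_generate_finite {S | ∃ K, ∃ A : Set (Fin s → Fin K → Fin b), S = r K ⁻¹' A}
    (le_antisymm ?_ ?_) ?_ ?_ (by simp)
  · simp only [MeasurableSpace.pi, MeasurableSpace.comap_iSup, MeasurableSpace.comap_comp]
    refine iSup₂_le fun j l => ?_
    rintro _ ⟨B, -, rfl⟩
    refine MeasurableSpace.measurableSet_generateFrom
      ⟨l + 1, {w | w j (Fin.last l) ∈ B}, ?_⟩
    ext u
    simp [hr]
  · refine MeasurableSpace.generateFrom_le ?_
    rintro _ ⟨K, A, rfl⟩
    exact hrm K .of_discrete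
  · rintro _ ⟨K, A, rfl⟩ _ ⟨K', A', rfl⟩ -
    refine ⟨max K K', {w | (fun j (l : Fin K) => w j (l.castLE (le_max_left _ _))) ∈ A ∧
      (fun j (l : Fin K') => w j (l.castLE (le_max_right _ _))) ∈ A'}, ?_⟩
    ext u
    simp [hr]
  · rintro _ ⟨K, A, rfl⟩
    rw [← Measure.map_apply (hrm K) .of_discrete, ← Measure.map_apply (hrm K) .of_discrete]
    congr 1
    refine Measure.ext_of_singleton fun w => ?_
    rw [Measure.map_apply (hrm K) .of_discrete, Measure.map_apply (hrm K) .of_discrete]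
    exact h K w

variable {s d b : ℕ} [NeZero b]

/-- The label of the permutation of the digit of index `k` of the `j`-th coordinate of `a`. -/
def permLabel (b : ℕ) [NeZero b] (a : Fin s → ℝ) (j : Fin s) (k : ℕ) : PermIndex s b :=
  (j, ⟨k, fun l : Fin k => (a j).digits b l⟩)

theorem measurable_scrambleDigits (a : Fin s → ℝ) :
    Measurable fun σ : PermIndex s b → Equiv.Perm (Fin b) => scrambleDigits σ a := by
  refine measurable_pi_lambda _ fun j => measurable_pi_lambda _ fun k => ?_
  exact (Measurable.of_discrete (f := fun ρ : Equiv.Perm (Fin b) => ρ ((a j).digits b k))).comp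
    (measurable_pi_apply (permLabel b a j k))

theorem permLabel_injective (a : Fin s → ℝ) :
    Function.Injective fun p : Fin s × ℕ => permLabel b a p.1 p.2 := by
  rintro ⟨j, k⟩ ⟨j', k'⟩ h
  simp only [permLabel, Prod.mk.injEq, Sigma.mk.injEq] at h
  exact Prod.ext h.1 h.2.1

/-- Different digits of one point use permutations with different labels. So its scrambled digits
are independent, and each is uniform. -/
theorem scrambleMeasure_digits_eq (a : Fin s → ℝ) (K : ℕ) (w : Fin s → Fin K → Fin b) :
    scrambleMeasure s b {σ | (fun j (l : Fin K) => scrambleDigits σ a j l) = w}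
      = ∏ _j : Fin s, ((b : ENNReal) ^ K)⁻¹ := by
  classical
  set e : Fin s × Fin K → PermIndex s b := fun p => permLabel b a p.1 p.2 with he
  have hinj : Function.Injective e := by
    intro p p' h
    have := permLabel_injective (b := b) a (a₁ := (p.1, (p.2 : ℕ))) (a₂ := (p'.1, (p'.2 : ℕ))) h
    simp only [Prod.mk.injEq] at this
    exact Prod.ext this.1 (Fin.ext this.2)
  set t : PermIndex s b → Set (Equiv.Perm (Fin b)) := fun q =>
    {τ | ∀ p, e p = q → τ ((a p.1).digits b p.2) = w p.1 p.2} with ht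
  have hset : {σ : PermIndex s b → Equiv.Perm (Fin b) |
      (fun j (l : Fin K) => scrambleDigits σ a j l) = w}
      = Set.pi (Finset.univ.image e : Finset (PermIndex s b)) t := by
    ext σ
    simp only [Set.mem_ofPred_eq, Set.mem_pi, Finset.coe_image, Finset.coe_univ, Set.image_univ,
      Set.mem_range, forall_exists_index, forall_apply_eq_imp_iff, ht]
    constructor
    · rintro rfl p p' hp
      rw [hinj hp]
      rfl
    · intro h
      funext j l
      exact h (j, l) (j, l) rfl
  have ht' : ∀ p, t (e p) = {τ | τ ((a p.1).digits b p.2) = w p.1 p.2} := by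
    intro p
    ext τ
    simp only [ht, Set.mem_ofPred_eq]
    exact ⟨fun h => h p rfl, fun h p' hp' => by rwa [hinj hp']⟩
  rw [hset, scrambleMeasure, Measure.infinitePi_pi _ fun _ _ => .of_discrete,
    Finset.prod_image fun _ _ _ _ h => hinj h]
  simp only [ht', permMeasure_apply_eq]
  rw [Fintype.prod_prod_type]
  simp [ENNReal.inv_pow]

variable {X : Fin s → Set (Block d)} (T : ∀ j, RecursiveSplit b (X j))

/-- The distribution of the addresses of a uniformly distributed point. -/
def addressMeasure : Measure (Fin s → ℕ → Fin b) :=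
  (volume.restrict (Set.univ.pi X)).map (blockAddress T)

theorem isProbabilityMeasure_restrict (hvol : ∀ j, volume (X j) = 1) :
    IsProbabilityMeasure (volume.restrict (Set.univ.pi X)) :=
  ⟨by simp [volume_pi_pi, hvol]⟩

theorem isProbabilityMeasure_addressMeasure (hvol : ∀ j, volume (X j) = 1) :
    IsProbabilityMeasure (addressMeasure T) := by
  have := isProbabilityMeasure_restrict hvol
  exact Measure.isProbabilityMeasure_map (measurable_blockAddress T).aemeasurable

theorem measurePreserving_blockAddress :
    MeasurePreserving (blockAddress T) (volume.restrict (Set.univ.pi X)) (addressMeasure T) :=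
  ⟨measurable_blockAddress T, rfl⟩

theorem measurePreserving_scrambleDigits (hvol : ∀ j, volume (X j) = 1) (a : Fin s → ℝ) :
    MeasurePreserving (fun σ => scrambleDigits σ a) (scrambleMeasure s b) (addressMeasure T) := by
  refine ⟨measurable_scrambleDigits a, ?_⟩
  have := isProbabilityMeasure_addressMeasure T hvol
  have : IsProbabilityMeasure ((scrambleMeasure s b).map fun σ => scrambleDigits σ a) :=
    Measure.isProbabilityMeasure_map (measurable_scrambleDigits a).aemeasurable
  refine measure_ext_of_digits fun K w => ?_
  have hr : Measurable fun (u : Fin s → ℕ → Fin b) j (l : Fin K) => u j l :=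
    measurable_pi_lambda _ fun j => measurable_pi_lambda _ fun l =>
      (measurable_pi_apply (l : ℕ)).comp (measurable_pi_apply j)
  have hm : MeasurableSet {u : Fin s → ℕ → Fin b | (fun j (l : Fin K) => u j l) = w} :=
    hr (measurableSet_singleton w)
  rw [Measure.map_apply (measurable_scrambleDigits a) hm, addressMeasure,
    Measure.map_apply (measurable_blockAddress T) hm]
  refine (scrambleMeasure_digits_eq a K w).trans ?_
  have h1 := congrArg (fun m => m Set.univ) (restrict_addressFiber T (fun _ => K) w)
  simp only [Measure.restrict_apply_univ] at h1
  refine Eq.trans ?_ h1.symm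
  rw [volume_pi_pi]
  exact Finset.prod_congr rfl fun j _ => ((T j).volume_cell (hvol j) K (w j)).symm

/-- The point with given addresses. -/
def pointOf (u : Fin s → ℕ → Fin b) : Pt s d := fun j => (T j).transform (u j)

theorem pointOf_blockAddress (hd : 1 ≤ d) (hb : 2 ≤ b) (hvol : ∀ j, volume (X j) = 1)
    (hT : ∀ j, (T j).Spherical) {x : Pt s d} (hx : x ∈ Set.univ.pi X) :
    pointOf T (blockAddress T x) = x :=
  funext fun j => (T j).transform_address hd hb (hvol j) (hT j) (hx j trivial)

/-- `pointOf` inverts the address map on the region. In particular a scrambled point lies in the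
region almost surely, although some digit sequences may lead outside it. -/
theorem measurePreserving_pointOf (hd : 1 ≤ d) (hb : 2 ≤ b) (hvol : ∀ j, volume (X j) = 1)
    (hT : ∀ j, (T j).Spherical) :
    MeasurePreserving (pointOf T) (addressMeasure T) (volume.restrict (Set.univ.pi X)) := by
  have hm : Measurable (pointOf T) := measurable_pi_lambda _ fun j =>
    ((T j).measurable_transform hd hb (hvol j) (hT j)).comp (measurable_pi_apply j)
  refine ⟨hm, ?_⟩
  rw [addressMeasure, Measure.map_map hm (measurable_blockAddress T)]
  refine (Measure.map_congr (g := id) ?_).trans Measure.map_id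
  filter_upwards [ae_restrict_mem (measurableSet_region T)] with x hx
  exact pointOf_blockAddress T hd hb hvol hT hx

/-! ### Functions of finitely many digits -/

theorem measurable_of_digits {κ : Fin s → ℕ} {h : (Fin s → ℕ → Fin b) → ℝ}
    (hh : ∀ u u' : Fin s → ℕ → Fin b, (∀ j, ∀ l < κ j, u j l = u' j l) → h u = h u') :
    Measurable h ∧ ∃ M, ∀ u, ‖h u‖ ≤ M := by
  set r : (Fin s → ℕ → Fin b) → ∀ j, Fin (κ j) → Fin b := fun u j l => u j l with hr
  set e : (∀ j, Fin (κ j) → Fin b) → Fin s → ℕ → Fin b := fun w j l =>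
    if hl : l < κ j then w j ⟨l, hl⟩ else 0 with he
  have hrm : Measurable r := measurable_pi_lambda _ fun j =>
    measurable_pi_lambda _ fun l => (measurable_pi_apply (l : ℕ)).comp (measurable_pi_apply j)
  have heq : ∀ u, h u = h (e (r u)) := fun u => hh _ _ fun j l hl => by simp [he, hr, hl]
  constructor
  · rw [show h = (fun w => h (e w)) ∘ r from funext heq]
    exact Measurable.of_discrete.comp hrm
  · obtain ⟨M, hM⟩ := (Set.finite_range fun w => ‖h (e w)‖).bddAbove
    exact ⟨M, fun u => heq u ▸ hM ⟨r u, rfl⟩⟩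

theorem measurable_contrast (g : Pt s d → ℝ) (κ : Fin s → ℕ) : Measurable (contrast T g κ) :=
  (measurable_of_digits (κ := fun j => κ j + 1) fun _ _ h =>
    contrast_congr T g fun j l hl => h j l (by omega)).1

theorem exists_norm_contrast_le (g : Pt s d → ℝ) (κ : Fin s → ℕ) :
    ∃ M, ∀ u, ‖contrast T g κ u‖ ≤ M :=
  (measurable_of_digits (κ := fun j => κ j + 1) fun _ _ h =>
    contrast_congr T g fun j l hl => h j l (by omega)).2

theorem measurable_cellMean (g : Pt s d → ℝ) (κ : Fin s → ℕ) : Measurable (cellMean T g κ) :=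
  (measurable_of_digits (κ := κ) fun _ _ h => cellMean_congr T g h).1

theorem exists_norm_cellMean_le (g : Pt s d → ℝ) (κ : Fin s → ℕ) :
    ∃ M, ∀ u, ‖cellMean T g κ u‖ ≤ M :=
  (measurable_of_digits (κ := κ) fun _ _ h => cellMean_congr T g h).2

end GeomNet
end

noncomputable section
namespace GeomNet

/-! ### Nets -/

theorem floor_eq_of_digits_eq {b : ℕ} [NeZero b] {x y : ℝ} (hx : x ∈ Set.Ico (0 : ℝ) 1)
    (hy : y ∈ Set.Ico (0 : ℝ) 1) {n : ℕ} (h : ∀ l < n, x.digits b l = y.digits b l) :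
    ⌊(b : ℝ) ^ n * x⌋₊ = ⌊(b : ℝ) ^ n * y⌋₊ := by
  have h1 := Real.ofDigits_digits_sum_eq (b := b) hx n
  have h2 := Real.ofDigits_digits_sum_eq (b := b) hy n
  have h3 : ∑ i ∈ Finset.range n, Real.ofDigitsTerm (x.digits b) i
      = ∑ i ∈ Finset.range n, Real.ofDigitsTerm (y.digits b) i :=
    Finset.sum_congr rfl fun i hi => by
      simp [Real.ofDigitsTerm, h i (Finset.mem_range.1 hi)]
  rw [h3, h2] at h1
  exact_mod_cast h1.symm

theorem floor_eq_of_mem_Ico {b : ℕ} (hb : b ≠ 0) {x : ℝ} {n c : ℕ}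
    (h : x ∈ Set.Ico ((c : ℝ) / (b : ℝ) ^ n) (((c : ℝ) + 1) / (b : ℝ) ^ n)) :
    ⌊(b : ℝ) ^ n * x⌋₊ = c := by
  have hb0 : (0 : ℝ) < (b : ℝ) ^ n := by
    have : (0 : ℝ) < b := by exact_mod_cast Nat.pos_of_ne_zero hb
    positivity
  rw [Set.mem_Ico, div_le_iff₀ hb0, lt_div_iff₀ hb0, mul_comm x] at h
  exact (Nat.floor_eq_iff ((Nat.cast_nonneg c).trans h.1)).2 h

/-- There are b^m boxes, each containing a point, and the boxes are disjoint; so the points exhaust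
the boxes bijectively. This also excludes coordinates equal to 1. -/
theorem IsNet.exists_box {s b m : ℕ} (hb : b ≠ 0) {a : Fin (b ^ m) → Fin s → ℝ}
    (h : IsNet b 0 m a) {κ : Fin s → ℕ} (hκ : ∑ j, κ j = m) (i : Fin (b ^ m)) :
    ∃ c : ∀ j, Fin (b ^ κ j), ∀ j, a i j ∈ Set.Ico (((c j : ℕ) : ℝ) / (b : ℝ) ^ κ j)
      ((((c j : ℕ) : ℝ) + 1) / (b : ℝ) ^ κ j) := by
  have h1 : ∀ c : ∀ j, Fin (b ^ κ j), ∃ i, ∀ j, a i j ∈ Set.Ico (((c j : ℕ) : ℝ) / (b : ℝ) ^ κ j)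
      ((((c j : ℕ) : ℝ) + 1) / (b : ℝ) ^ κ j) := by
    intro c
    have h2 := h.card κ (fun j => c j) (fun j => (c j).2) (by simpa using hκ)
    rw [pow_zero, Set.ncard_eq_one] at h2
    obtain ⟨i, hi⟩ := h2
    exact ⟨i, (Set.ext_iff.1 hi i).2 rfl⟩
  choose g hg using h1
  have hinj : Function.Injective g := by
    intro c c' hcc
    funext j
    have h2 := hg c j
    rw [hcc] at h2
    exact Fin.ext ((floor_eq_of_mem_Ico hb h2).symm.trans (floor_eq_of_mem_Ico hb (hg c' j)))
  have hcard : Fintype.card (∀ j, Fin (b ^ κ j)) = Fintype.card (Fin (b ^ m)) := by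
    simp [Fintype.card_pi, Finset.prod_pow_eq_pow_sum, hκ]
  obtain ⟨c, hc⟩ := ((Fintype.bijective_iff_injective_and_card g).2 ⟨hinj, hcard⟩).2 i
  exact ⟨c, hc ▸ hg c⟩

theorem IsNet.exists_digits_ne {s b m : ℕ} [NeZero b] {a : Fin (b ^ m) → Fin s → ℝ}
    (h : IsNet b 0 m a) {κ : Fin s → ℕ} (hκ : ∑ j, κ j = m) {i i' : Fin (b ^ m)} (hi : i ≠ i') :
    ∃ j, (fun l : Fin (κ j) => (a i j).digits b l) ≠ fun l : Fin (κ j) => (a i' j).digits b l := by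
  by_contra! hcon
  have hb := NeZero.ne b
  obtain ⟨c, hc⟩ := h.exists_box hb hκ i
  obtain ⟨c', hc'⟩ := h.exists_box hb hκ i'
  have h01 : ∀ {x : ℝ} {k : ℕ} {c : Fin (b ^ k)}, x ∈ Set.Ico (((c : ℕ) : ℝ) / (b : ℝ) ^ k)
      ((((c : ℕ) : ℝ) + 1) / (b : ℝ) ^ k) → x ∈ Set.Ico (0 : ℝ) 1 := by
    intro x k c hx
    have hb0 : (0 : ℝ) < (b : ℝ) ^ k := by
      have : (0 : ℝ) < b := by exact_mod_cast Nat.pos_of_ne_zero hb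
      positivity
    refine ⟨le_trans (by positivity) hx.1, hx.2.trans_le ?_⟩
    rw [div_le_one hb0]
    exact_mod_cast c.2
  have hcc : c = c' := by
    funext j
    have h1 := floor_eq_of_digits_eq (b := b) (h01 (hc j)) (h01 (hc' j)) (n := κ j)
      fun l hl => congrFun (hcon j) ⟨l, hl⟩
    exact Fin.ext ((floor_eq_of_mem_Ico hb (hc j)).symm.trans
      (h1.trans (floor_eq_of_mem_Ico hb (hc' j))))
  have h2 := h.card κ (fun j => c j) (fun j => (c j).2) (by simpa using hκ)
  rw [pow_zero, Set.ncard_eq_one] at h2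
  obtain ⟨i₀, hi₀⟩ := h2
  have h3 : i = i₀ := (Set.ext_iff.1 hi₀ i).1 hc
  have h4 : i' = i₀ := (Set.ext_iff.1 hi₀ i').1 (hcc ▸ hc')
  exact hi (h3.trans h4.symm)

/-! ### Orthogonality -/

variable {s d b : ℕ} [NeZero b]

theorem scrambleDigits_update_self (σ : PermIndex s b → Equiv.Perm (Fin b)) (a : Fin s → ℝ)
    (j : Fin s) (k : ℕ) (ρ : Equiv.Perm (Fin b)) :
    scrambleDigits (Function.update σ (permLabel b a j k) ρ) a
      = Function.update (scrambleDigits σ a) j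
        (Function.update (scrambleDigits σ a j) k (ρ ((a j).digits b k))) := by
  funext j' k'
  by_cases h : j' = j ∧ k' = k
  · obtain ⟨rfl, rfl⟩ := h
    simp only [Function.update_self]
    change Function.update σ (permLabel b a j' k') ρ (permLabel b a j' k') _ = _
    rw [Function.update_self]
  · have hne : permLabel b a j' k' ≠ permLabel b a j k := fun he => h (by
      have := permLabel_injective a (a₁ := (j', k')) (a₂ := (j, k)) he
      simpa using this)
    change Function.update σ (permLabel b a j k) ρ (permLabel b a j' k') _ = _
    rw [Function.update_of_ne hne]
    rcases eq_or_ne j' j with rfl | hj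
    · have hk : k' ≠ k := fun hk => h ⟨rfl, hk⟩
      simp [hk, scrambleDigits, permLabel]
    · simp [hj, scrambleDigits, permLabel]

/-- The label of a permutation contains the preceding digits of the unscrambled point, so points
that have already separated in block j never share it. -/
theorem scrambleDigits_update_of_ne (σ : PermIndex s b → Equiv.Perm (Fin b)) {a a' : Fin s → ℝ}
    {j : Fin s} {k : ℕ}
    (h : (fun l : Fin k => (a j).digits b l) ≠ fun l : Fin k => (a' j).digits b l)
    (ρ : Equiv.Perm (Fin b)) :
    scrambleDigits (Function.update σ (permLabel b a j k) ρ) a' = scrambleDigits σ a' := by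
  funext j' k'
  have hne : permLabel b a' j' k' ≠ permLabel b a j k := by
    intro he
    simp only [permLabel, Prod.mk.injEq, Sigma.mk.injEq] at he
    obtain ⟨rfl, rfl, he⟩ := he
    exact h (eq_of_heq he).symm
  change Function.update σ (permLabel b a j k) ρ (permLabel b a' j' k') _ = _
  rw [Function.update_of_ne hne]
  rfl

variable {X : Fin s → Set (Block d)} (T : ∀ j, RecursiveSplit b (X j))

/-- Composing the permutation that produces the digit of index κ_j with a rotation x ↦ x + c
preserves the scramble distribution and leaves `H` unchanged. So the integral is the same for all b
rotations, while the rotated contrasts sum to zero. -/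
theorem integral_mul_contrast_eq_zero (hvol : ∀ j, volume (X j) = 1) {f : Pt s d → ℝ}
    (hf : IntegrableOn f (Set.univ.pi X)) (κ : Fin s → ℕ) (a : Fin s → ℝ) (j : Fin s)
    {H : (PermIndex s b → Equiv.Perm (Fin b)) → ℝ} (hH : Integrable H (scrambleMeasure s b))
    (hHσ : ∀ σ ρ, H (Function.update σ (permLabel b a j (κ j)) ρ) = H σ) :
    ∫ σ, H σ * contrast T f κ (scrambleDigits σ a) ∂(scrambleMeasure s b) = 0 := by
  obtain ⟨M, hM⟩ := exists_norm_contrast_le T f κ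
  have hint : Integrable (fun σ => H σ * contrast T f κ (scrambleDigits σ a))
      (scrambleMeasure s b) :=
    hH.mul_bdd (c := M)
      ((measurable_contrast T f κ).comp (measurable_scrambleDigits a)).aestronglyMeasurable
      (Eventually.of_forall fun σ => hM _)
  set τ : Fin b → PermIndex s b → Equiv.Perm (Fin b) := fun c =>
    Function.update 1 (permLabel b a j (κ j)) (Equiv.addRight c) with hτ
  have hupd : ∀ c (σ : PermIndex s b → Equiv.Perm (Fin b)), τ c * σ
      = Function.update σ (permLabel b a j (κ j))
        (Equiv.addRight c * σ (permLabel b a j (κ j))) := by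
    intro c σ
    funext q
    rcases eq_or_ne q (permLabel b a j (κ j)) with rfl | hq
    · simp [hτ]
    · simp [hτ, hq]
  have hcomp : ∀ c σ, H (τ c * σ) * contrast T f κ (scrambleDigits (τ c * σ) a)
      = H σ * contrast T f κ (Function.update (scrambleDigits σ a) j
        (Function.update (scrambleDigits σ a j) (κ j) (scrambleDigits σ a j (κ j) + c))) := by
    intro c σ
    rw [hupd, hHσ, scrambleDigits_update_self]
    rfl
  have h1 : ∀ c, ∫ σ, H σ * contrast T f κ (Function.update (scrambleDigits σ a) j
        (Function.update (scrambleDigits σ a j) (κ j) (scrambleDigits σ a j (κ j) + c)))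
        ∂(scrambleMeasure s b)
      = ∫ σ, H σ * contrast T f κ (scrambleDigits σ a) ∂(scrambleMeasure s b) := by
    intro c
    rw [← (measurePreserving_mul_left (τ c)).integral_comp_of_aestronglyMeasurable
      hint.aestronglyMeasurable]
    exact integral_congr_ae (Eventually.of_forall fun σ => (hcomp c σ).symm)
  have h2 : ∀ c, Integrable (fun σ => H σ * contrast T f κ (Function.update (scrambleDigits σ a) j
        (Function.update (scrambleDigits σ a j) (κ j) (scrambleDigits σ a j (κ j) + c))))
        (scrambleMeasure s b) := by
    intro c
    refine ((measurePreserving_mul_left (τ c)).integrable_comp_of_integrable hint).congr ?_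
    exact Eventually.of_forall fun σ => hcomp c σ
  have h3 : ∑ c : Fin b, ∫ σ, H σ * contrast T f κ (Function.update (scrambleDigits σ a) j
        (Function.update (scrambleDigits σ a j) (κ j) (scrambleDigits σ a j (κ j) + c)))
        ∂(scrambleMeasure s b) = 0 := by
    rw [← integral_finsetSum _ fun c _ => h2 c]
    refine integral_eq_zero_of_ae (Eventually.of_forall fun σ => ?_)
    simp only [← Finset.mul_sum, Pi.zero_apply]
    have := Equiv.sum_comp (Equiv.addLeft (scrambleDigits σ a j (κ j))) fun c =>
      contrast T f κ (Function.update (scrambleDigits σ a) j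
        (Function.update (scrambleDigits σ a j) (κ j) c))
    simp only [Equiv.coe_addLeft] at this
    rw [this, sum_contrast_update T (NeZero.ne b) hvol hf, mul_zero]
  simp only [h1, Finset.sum_const, Finset.card_univ, Fintype.card_fin, nsmul_eq_mul] at h3
  exact (mul_eq_zero.1 h3).resolve_left (by exact_mod_cast NeZero.ne b)

theorem integral_addressMeasure_mul_contrast_eq_zero (hvol : ∀ j, volume (X j) = 1)
    {f : Pt s d → ℝ} (hf : IntegrableOn f (Set.univ.pi X)) (κ : Fin s → ℕ) (j : Fin s)
    {H : (Fin s → ℕ → Fin b) → ℝ} (hH : Integrable H (addressMeasure T))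
    (hHu : ∀ u c, H (Function.update u j (Function.update (u j) (κ j) c)) = H u) :
    ∫ u, H u * contrast T f κ u ∂(addressMeasure T) = 0 := by
  -- The scramble of any fixed point realizes `addressMeasure`; the point 0 is an arbitrary choice.
  have hmp := measurePreserving_scrambleDigits T hvol 0
  rw [← hmp.integral_comp_of_aestronglyMeasurable (g := fun u => H u * contrast T f κ u)
    (hH.aestronglyMeasurable.mul (measurable_contrast T f κ).aestronglyMeasurable)]
  refine integral_mul_contrast_eq_zero T hvol hf κ 0 j (H := fun σ => H (scrambleDigits σ 0))
    (hmp.integrable_comp_of_integrable hH) fun σ ρ => ?_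
  rw [scrambleDigits_update_self, hHu]

theorem integral_sum_mul_sum_contrast (hvol : ∀ j, volume (X j) = 1)
    {f : Pt s d → ℝ} (hf : IntegrableOn f (Set.univ.pi X)) {m : ℕ}
    {a : Fin (b ^ m) → Fin s → ℝ} (ha : IsNet b 0 m a) {κ : Fin s → ℕ} (hκ : ∑ j, κ j = m)
    {H : (Fin s → ℕ → Fin b) → ℝ} (hH : Integrable H (addressMeasure T)) :
    ∫ σ, (∑ i, H (scrambleDigits σ (a i))) * ∑ i, contrast T f κ (scrambleDigits σ (a i))
        ∂(scrambleMeasure s b)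
      = (b : ℝ) ^ m * ∫ u, H u * contrast T f κ u ∂(addressMeasure T) := by
  obtain ⟨M, hM⟩ := exists_norm_contrast_le T f κ
  have hmp := fun i => measurePreserving_scrambleDigits T hvol (a i)
  have hHi := fun i => (hmp i).integrable_comp_of_integrable hH
  have hint : ∀ i i', Integrable (fun σ => H (scrambleDigits σ (a i')) *
      contrast T f κ (scrambleDigits σ (a i))) (scrambleMeasure s b) := fun i i' =>
    (hHi i').mul_bdd (c := M)
      ((measurable_contrast T f κ).comp (measurable_scrambleDigits (a i))).aestronglyMeasurable
      (Eventually.of_forall fun σ => hM _)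
  have h1 : ∀ i i', ∫ σ, H (scrambleDigits σ (a i')) * contrast T f κ (scrambleDigits σ (a i))
      ∂(scrambleMeasure s b)
      = if i' = i then ∫ u, H u * contrast T f κ u ∂(addressMeasure T) else 0 := by
    intro i i'
    split_ifs with h
    · subst h
      exact (hmp i').integral_comp_of_aestronglyMeasurable
        (hH.aestronglyMeasurable.mul (measurable_contrast T f κ).aestronglyMeasurable)
    · obtain ⟨j, hj⟩ := ha.exists_digits_ne hκ (Ne.symm h)
      exact integral_mul_contrast_eq_zero T hvol hf κ (a i) j (hHi i') fun σ ρ =>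
        congrArg H (scrambleDigits_update_of_ne σ hj ρ)
  simp only [Finset.sum_mul, Finset.mul_sum]
  rw [integral_finsetSum _ fun i _ => integrable_finsetSum _ fun i' _ => hint i i']
  simp only [integral_finsetSum _ fun i' _ => hint _ i', h1]
  simp

end GeomNet
end

noncomputable section
namespace GeomNet

variable {s d b : ℕ} [NeZero b] {X : Fin s → Set (Block d)} (T : ∀ j, RecursiveSplit b (X j))

/-! ### Inner products of contrasts -/

theorem integrable_contrast (hvol : ∀ j, volume (X j) = 1) (f : Pt s d → ℝ) (κ : Fin s → ℕ) :
    Integrable (contrast T f κ) (addressMeasure T) := by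
  have := isProbabilityMeasure_addressMeasure T hvol
  obtain ⟨M, hM⟩ := exists_norm_contrast_le T f κ
  exact Integrable.of_bound (measurable_contrast T f κ).aestronglyMeasurable M
    (Eventually.of_forall hM)

theorem integrable_cellMean (hvol : ∀ j, volume (X j) = 1) (f : Pt s d → ℝ) (κ : Fin s → ℕ) :
    Integrable (cellMean T f κ) (addressMeasure T) := by
  have := isProbabilityMeasure_addressMeasure T hvol
  obtain ⟨M, hM⟩ := exists_norm_cellMean_le T f κ
  exact Integrable.of_bound (measurable_cellMean T f κ).aestronglyMeasurable M
    (Eventually.of_forall hM)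

theorem Integrable.mul_contrast {H : (Fin s → ℕ → Fin b) → ℝ}
    (hH : Integrable H (addressMeasure T)) (f : Pt s d → ℝ) (κ : Fin s → ℕ) :
    Integrable (fun u => H u * contrast T f κ u) (addressMeasure T) := by
  obtain ⟨M, hM⟩ := exists_norm_contrast_le T f κ
  exact hH.mul_bdd (c := M) (measurable_contrast T f κ).aestronglyMeasurable
    (Eventually.of_forall hM)

/-- Equal sums force κ'_j < κ_j for some j, and then the contrast of level κ' does not see the digit
of index κ_j in block j. -/
theorem integral_contrast_mul_contrast_of_ne (hvol : ∀ j, volume (X j) = 1) {f : Pt s d → ℝ}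
    (hf : IntegrableOn f (Set.univ.pi X)) {κ κ' : Fin s → ℕ} (hκ : κ' ≠ κ)
    (hsum : ∑ j, κ' j = ∑ j, κ j) :
    ∫ u, contrast T f κ' u * contrast T f κ u ∂(addressMeasure T) = 0 := by
  obtain ⟨j, hj⟩ : ∃ j, κ' j < κ j := by
    by_contra! hcon
    refine hκ (funext fun j => ?_)
    exact (((Finset.sum_eq_sum_iff_of_le fun j _ => hcon j).1 hsum.symm) j (Finset.mem_univ j)).symm
  refine integral_addressMeasure_mul_contrast_eq_zero T hvol hf κ j
    (integrable_contrast T hvol f κ') fun u c => contrast_congr T f fun l n hn => ?_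
  rcases eq_or_ne l j with rfl | hl
  · have : n ≠ κ l := by omega
    simp [this]
  · simp [hl]

/-- Conditioning on the first κ_j + 1 digits replaces f by the cell mean for v = ∅. Every other cell
mean in the expansion of the contrast omits the digit of index κ_j for some j ∈ v, so it is
orthogonal to the contrast. -/
theorem integral_mul_contrast_self (hd : 1 ≤ d) (hb : 2 ≤ b) (hvol : ∀ j, volume (X j) = 1)
    (hT : ∀ j, (T j).Spherical) {f : Pt s d → ℝ} (hf : IntegrableOn f (Set.univ.pi X))
    (κ : Fin s → ℕ) :
    ∫ u, f (pointOf T u) * contrast T f κ u ∂(addressMeasure T)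
      = ∫ u, contrast T f κ u ^ 2 ∂(addressMeasure T) := by
  have hmp := measurePreserving_blockAddress T
  have hF := (measurePreserving_pointOf T hd hb hvol hT).integrable_comp_of_integrable hf
  have h1 : ∫ u, f (pointOf T u) * contrast T f κ u ∂(addressMeasure T)
      = ∫ u, cellMean T f (fun j => κ j + 1) u * contrast T f κ u ∂(addressMeasure T) := by
    rw [← hmp.integral_comp_of_aestronglyMeasurable
        (g := fun u => f (pointOf T u) * contrast T f κ u)
        (hF.aestronglyMeasurable.mul (measurable_contrast T f κ).aestronglyMeasurable),
      ← hmp.integral_comp_of_aestronglyMeasurable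
        (g := fun u => cellMean T f (fun j => κ j + 1) u * contrast T f κ u)
        ((measurable_cellMean T f _).mul (measurable_contrast T f κ)).aestronglyMeasurable]
    have h2 := integral_mul_blockAddress T (NeZero.ne b) hvol hf (fun j => κ j + 1)
      (h := contrast T f κ) fun u u' h => contrast_congr T f fun j l hl => h j l (by omega)
    rw [← h2]
    refine setIntegral_congr_fun (measurableSet_region T) fun x hx => ?_
    simp only [pointOf_blockAddress T hd hb hvol hT hx]
  rw [h1]
  have h3 : ∀ u, contrast T f κ u ^ 2 = ∑ v : Finset (Fin s), (-1) ^ v.card *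
      (cellMean T f (fun j => if j ∈ v then κ j else κ j + 1) u * contrast T f κ u) := by
    intro u
    simp only [← mul_assoc]
    rw [← Finset.sum_mul, sq]
    rfl
  simp only [h3]
  rw [integral_finsetSum _ fun v _ =>
    (Integrable.mul_contrast T (integrable_cellMean T hvol f _) f κ).const_mul _]
  simp only [integral_const_mul]
  rw [Finset.sum_eq_single ∅]
  · simp
  · intro v _ hv
    obtain ⟨j, hj⟩ := Finset.nonempty_iff_ne_empty.2 hv
    rw [integral_addressMeasure_mul_contrast_eq_zero T hvol hf κ j
      (integrable_cellMean T hvol f _), mul_zero]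
    refine fun u c => cellMean_congr T f fun l n hn => ?_
    rcases eq_or_ne l j with rfl | hl
    · have : n ≠ κ l := by
        simp only [hj, if_true] at hn
        exact hn.ne
      simp [this]
    · simp [hl]
  · intro h
    exact absurd (Finset.mem_univ _) h

/-! ### Lower bounds for the components of the variance -/

theorem measurePreserving_rotate (hvol : ∀ j, volume (X j) = 1) (κ : Fin s → ℕ)
    (c : Fin s → Fin b) :
    MeasurePreserving (fun u => setDigits κ u fun j => u j (κ j) + c j) (addressMeasure T)
      (addressMeasure T) := by
  have hm : Measurable fun u : Fin s → ℕ → Fin b => setDigits κ u fun j => u j (κ j) + c j := by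
    refine measurable_pi_lambda _ fun j => measurable_pi_lambda _ fun k => ?_
    rcases eq_or_ne k (κ j) with rfl | hk
    · simp only [setDigits, Function.update_self]
      exact (Measurable.of_discrete (f := fun x : Fin b => x + c j)).comp
        ((measurable_pi_apply (κ j)).comp (measurable_pi_apply j))
    · simp only [setDigits, Function.update_of_ne hk]
      exact (measurable_pi_apply k).comp (measurable_pi_apply j)
  refine ⟨hm, ?_⟩
  set τ : PermIndex s b → Equiv.Perm (Fin b) := fun q =>
    if q.2.1 = κ q.1 then Equiv.addRight (c q.1) else 1 with hτ
  have h0 := measurePreserving_scrambleDigits T hvol 0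
  have h1 := h0.comp (measurePreserving_mul_left τ)
  have h2 : (fun u : Fin s → ℕ → Fin b => setDigits κ u fun j => u j (κ j) + c j) ∘
      (fun σ : PermIndex s b → Equiv.Perm (Fin b) => scrambleDigits σ 0)
      = (fun σ => scrambleDigits σ 0) ∘ fun σ => τ * σ := by
    funext σ j k
    rcases eq_or_ne k (κ j) with rfl | hk
    · simp [setDigits, scrambleDigits, hτ]
    · simp [setDigits, scrambleDigits, hτ, hk]
  conv_lhs => rw [← h0.map_eq]
  rw [Measure.map_map hm h0.measurable, h2, h1.map_eq]

/-- Summing over all values of the digits is summing over all rotations of the present ones, and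
each rotation preserves the measure. -/
theorem integral_sum_contrast_setDigits_sq (hvol : ∀ j, volume (X j) = 1) (f : Pt s d → ℝ)
    (κ : Fin s → ℕ) :
    ∫ u, ∑ c : Fin s → Fin b, contrast T f κ (setDigits κ u c) ^ 2 ∂(addressMeasure T)
      = (b : ℝ) ^ s * ∫ u, contrast T f κ u ^ 2 ∂(addressMeasure T) := by
  have hint : Integrable (fun u => contrast T f κ u ^ 2) (addressMeasure T) := by
    simp only [sq]
    exact Integrable.mul_contrast T (integrable_contrast T hvol f κ) f κ
  have h1 : ∀ u : Fin s → ℕ → Fin b,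
      ∑ c : Fin s → Fin b, contrast T f κ (setDigits κ u c) ^ 2
      = ∑ c : Fin s → Fin b, contrast T f κ (setDigits κ u fun j => u j (κ j) + c j) ^ 2 :=
    fun u => (Equiv.sum_comp (Equiv.addLeft fun j => u j (κ j)) fun c =>
      contrast T f κ (setDigits κ u c) ^ 2).symm
  simp only [h1]
  have hi : ∀ c : Fin s → Fin b,
      Integrable (fun u => contrast T f κ (setDigits κ u fun j => u j (κ j) + c j) ^ 2)
        (addressMeasure T) := fun c =>
    (measurePreserving_rotate T hvol κ c).integrable_comp_of_integrable hint
  have h2 : ∀ c : Fin s → Fin b,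
      ∫ u, contrast T f κ (setDigits κ u fun j => u j (κ j) + c j) ^ 2 ∂(addressMeasure T)
      = ∫ u, contrast T f κ u ^ 2 ∂(addressMeasure T) := fun c =>
    (measurePreserving_rotate T hvol κ c).integral_comp_of_aestronglyMeasurable
      (g := fun u => contrast T f κ u ^ 2) hint.aestronglyMeasurable
  rw [integral_finsetSum _ fun c _ => hi c]
  simp [h2]

theorem integral_cellMean (hvol : ∀ j, volume (X j) = 1) {g : Pt s d → ℝ}
    (hg : IntegrableOn g (Set.univ.pi X)) (κ : Fin s → ℕ) :
    ∫ u, cellMean T g κ u ∂(addressMeasure T) = ∫ x in Set.univ.pi X, g x := by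
  rw [← (measurePreserving_blockAddress T).integral_comp_of_aestronglyMeasurable
    (measurable_cellMean T g κ).aestronglyMeasurable]
  have := integral_mul_blockAddress T (NeZero.ne b) hvol hg κ (h := fun _ => 1) fun _ _ _ => rfl
  simpa using this.symm

theorem sq_integral_le_integral_cellMean_sq (hvol : ∀ j, volume (X j) = 1) {g : Pt s d → ℝ}
    (hg : IntegrableOn g (Set.univ.pi X)) (κ : Fin s → ℕ) :
    Integrable (fun u => cellMean T g κ u ^ 2) (addressMeasure T) ∧
    (∫ x in Set.univ.pi X, g x) ^ 2 ≤ ∫ u, cellMean T g κ u ^ 2 ∂(addressMeasure T) := by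
  have := isProbabilityMeasure_addressMeasure T hvol
  obtain ⟨M, hM⟩ := exists_norm_cellMean_le T g κ
  have hL : MemLp (cellMean T g κ) 2 (addressMeasure T) :=
    MemLp.of_bound (measurable_cellMean T g κ).aestronglyMeasurable M (Eventually.of_forall hM)
  refine ⟨hL.integrable_sq, ?_⟩
  have h1 := variance_eq_sub hL
  have h2 := variance_nonneg (cellMean T g κ) (addressMeasure T)
  rw [integral_cellMean T hvol hg] at h1
  simp only [Pi.pow_apply] at h1
  linarith

theorem exists_level_le_integral_contrast_sq (hd : 1 ≤ d) (hb : 2 ≤ b)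
    (hvol : ∀ j, volume (X j) = 1) (hX : SobolExtensible (Set.univ.pi X))
    (hT : ∀ j, (T j).Spherical) {f : Pt s d → ℝ} {D : GradFamily s d}
    (hD : IsMixedGradient (Set.univ.pi X) f D) (hH : HolderOn (Set.univ.pi X) D)
    (hD₁ : 0 < ‖∫ x in Set.univ.pi X, D Finset.univ x‖ ^ 2)
    (hf : IntegrableOn f (Set.univ.pi X)) {c₀ : ℝ} (hc₀ : 0 < c₀)
    (hA : ∀ (j : Fin s) (k : ℕ) (w : Fin k → Fin b),
      c₀ * (b : ℝ) ^ (-(2 * (k : ℝ) / (d : ℝ))) ≤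
        minEigenvalue ((T j).centerMatrix_isHermitian k w)) :
    ∃ c₁ : ℝ, 0 < c₁ ∧ ∃ k₀ : ℕ, ∀ κ : Fin s → ℕ, (∀ j, k₀ ≤ κ j) →
      c₁ * (∏ j, (b : ℝ) ^ (-(2 * (κ j : ℝ) / (d : ℝ)))) ≤
        ∫ u, contrast T f κ u ^ 2 ∂(addressMeasure T) := by
  have hprob := isProbabilityMeasure_addressMeasure T hvol
  have hb0 : (0 : ℝ) < b := by exact_mod_cast (by omega : 0 < b)
  set γ := ∑ η : Fin s → Fin d, (∫ x in Set.univ.pi X, partials D Finset.univ η x) ^ 2 with hγdef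
  have hγ : 0 < γ := sum_integral_partials_sq_pos hD₁
  -- The averaged main term is at least c₀^s γ / 2, and δ uses up half of this. The factor b^s in
  -- the constant below accounts for the sum over children.
  obtain ⟨k₀, hk₀⟩ := exists_level_le_sum_contrast_sq T hd hb hvol hX hT hD hH hD₁ hf hc₀ hA
    (δ := c₀ ^ s * γ / 4) (by positivity)
  refine ⟨c₀ ^ s * γ / 4 / (b : ℝ) ^ s, by positivity, k₀, fun κ hκ => ?_⟩
  set R := ∏ j, (b : ℝ) ^ (-(2 * (κ j : ℝ) / (d : ℝ))) with hR
  have hR0 : 0 ≤ R := Finset.prod_nonneg fun j _ => by positivity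
  have hG := fun η => sq_integral_le_integral_cellMean_sq T hvol
    (integrableOn_partials hD₁ η) κ
  have hGi : Integrable (fun u => ∑ η, cellMean T (partials D Finset.univ η) κ u ^ 2)
      (addressMeasure T) := integrable_finsetSum _ fun η _ => (hG η).1
  have hlow : Integrable (fun u => R * (c₀ ^ s / 2 *
      ∑ η, cellMean T (partials D Finset.univ η) κ u ^ 2 - c₀ ^ s * γ / 4)) (addressMeasure T) :=
    ((hGi.const_mul _).sub (integrable_const _)).const_mul _
  have hup : Integrable (fun u => ∑ c : Fin s → Fin b, contrast T f κ (setDigits κ u c) ^ 2)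
      (addressMeasure T) := by
    obtain ⟨M, hM⟩ := exists_norm_contrast_le T f κ
    refine integrable_finsetSum _ fun c _ => Integrable.of_bound (C := M ^ 2) ?_ ?_
    · have hm : Measurable fun u : Fin s → ℕ → Fin b => setDigits κ u c := by
        refine measurable_pi_lambda _ fun j => measurable_pi_lambda _ fun k => ?_
        rcases eq_or_ne k (κ j) with rfl | hk
        · simp only [setDigits, Function.update_self]
          exact measurable_const
        · simp only [setDigits, Function.update_of_ne hk]
          exact (measurable_pi_apply k).comp (measurable_pi_apply j)
      exact (((measurable_contrast T f κ).comp hm).pow_const 2).aestronglyMeasurable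
    · refine Eventually.of_forall fun u => ?_
      rw [norm_pow]
      exact pow_le_pow_left₀ (norm_nonneg _) (hM _) 2
  have h1 := integral_mono hlow hup (hk₀ κ hκ)
  rw [integral_sum_contrast_setDigits_sq T hvol, integral_const_mul,
    integral_sub (hGi.const_mul _) (integrable_const _), integral_const_mul,
    integral_finsetSum _ fun η _ => (hG η).1] at h1
  simp only [integral_const, probReal_univ, one_smul] at h1
  have h2 : γ ≤ ∑ η, ∫ u, cellMean T (partials D Finset.univ η) κ u ^ 2 ∂(addressMeasure T) :=
    Finset.sum_le_sum fun η _ => (hG η).2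
  have h3 : R * (c₀ ^ s * γ / 4) ≤ (b : ℝ) ^ s * ∫ u, contrast T f κ u ^ 2 ∂(addressMeasure T) := by
    refine le_trans (mul_le_mul_of_nonneg_left ?_ hR0) h1
    have : c₀ ^ s / 2 * γ ≤ c₀ ^ s / 2 *
        ∑ η, ∫ u, cellMean T (partials D Finset.univ η) κ u ^ 2 ∂(addressMeasure T) :=
      mul_le_mul_of_nonneg_left h2 (by positivity)
    linarith
  rw [div_mul_eq_mul_div, div_le_iff₀ (by positivity)]
  linarith

/-! ### The variance of the estimator -/

theorem memLp_comp_pointOf (hd : 1 ≤ d) (hb : 2 ≤ b) (hvol : ∀ j, volume (X j) = 1)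
    (hT : ∀ j, (T j).Spherical) {f : Pt s d → ℝ} (hf : MemLp f 2 (volume.restrict (Set.univ.pi X))) :
    MemLp (fun u => f (pointOf T u)) 2 (addressMeasure T) :=
  hf.comp_measurePreserving (measurePreserving_pointOf T hd hb hvol hT)

theorem memLp_estimator (hd : 1 ≤ d) (hb : 2 ≤ b) (hvol : ∀ j, volume (X j) = 1)
    (hT : ∀ j, (T j).Spherical) {f : Pt s d → ℝ} (hf : MemLp f 2 (volume.restrict (Set.univ.pi X)))
    {m : ℕ} (a : Fin (b ^ m) → Fin s → ℝ) :
    MemLp (estimator T f a) 2 (scrambleMeasure s b) :=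
  (memLp_finsetSum _ fun i _ => (memLp_comp_pointOf T hd hb hvol hT hf).comp_measurePreserving
    (measurePreserving_scrambleDigits T hvol (a i))).const_mul _

/-- The centered integrand is split into `Q`, the sum of the contrasts in `S`, and a remainder `H`
orthogonal to each of them. Their sums over the net, `B` and `A`, stay orthogonal by
`integral_sum_mul_sum_contrast`, so the variance is at least that of `B` alone. -/
theorem le_variance_estimator (hs : 1 ≤ s) (hd : 1 ≤ d) (hb : 2 ≤ b)
    (hvol : ∀ j, volume (X j) = 1) (hT : ∀ j, (T j).Spherical) {f : Pt s d → ℝ}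
    (hf : MemLp f 2 (volume.restrict (Set.univ.pi X))) {m : ℕ} {a : Fin (b ^ m) → Fin s → ℝ}
    (ha : IsNet b 0 m a) {S : Finset (Fin s → ℕ)} (hS : ∀ κ ∈ S, ∑ j, κ j = m) :
    1 / (b : ℝ) ^ m * ∑ κ ∈ S, ∫ u, contrast T f κ u ^ 2 ∂(addressMeasure T)
      ≤ variance (estimator T f a) (scrambleMeasure s b) := by
  have hprob := isProbabilityMeasure_addressMeasure T hvol
  have hprob_restrict := isProbabilityMeasure_restrict hvol
  have hb0 : (0 : ℝ) < (b : ℝ) ^ m := by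
    have : (0 : ℝ) < b := by exact_mod_cast (by omega : 0 < b)
    positivity
  have hfi : IntegrableOn f (Set.univ.pi X) := hf.integrable (by norm_num)
  have hest := memLp_estimator T hd hb hvol hT hf a
  have hF := memLp_comp_pointOf T hd hb hvol hT hf
  have hFi : Integrable (fun u => f (pointOf T u)) (addressMeasure T) := hF.integrable (by norm_num)
  have hmp := fun i => measurePreserving_scrambleDigits T hvol (a i)
  have hcL : ∀ κ, MemLp (contrast T f κ) 2 (addressMeasure T) := fun κ => by
    obtain ⟨M, hM⟩ := exists_norm_contrast_le T f κ
    exact MemLp.of_bound (measurable_contrast T f κ).aestronglyMeasurable M (Eventually.of_forall hM)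
  set e := ∫ σ, estimator T f a σ ∂(scrambleMeasure s b) with he
  set Q : (Fin s → ℕ → Fin b) → ℝ := fun u => ∑ κ ∈ S, contrast T f κ u with hQ
  set H : (Fin s → ℕ → Fin b) → ℝ := fun u => f (pointOf T u) - e - Q u with hH
  have hQL : MemLp Q 2 (addressMeasure T) := memLp_finsetSum _ fun κ _ => hcL κ
  have hHL : MemLp H 2 (addressMeasure T) := (hF.sub (memLp_const e)).sub hQL
  have hQi : Integrable Q (addressMeasure T) := hQL.integrable (by norm_num)
  have hHi : Integrable H (addressMeasure T) := hHL.integrable (by norm_num)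
  have hQc : ∀ κ ∈ S, ∫ u, Q u * contrast T f κ u ∂(addressMeasure T)
      = ∫ u, contrast T f κ u ^ 2 ∂(addressMeasure T) := by
    intro κ hκ
    simp only [hQ, Finset.sum_mul]
    rw [integral_finsetSum _ fun κ' _ =>
      Integrable.mul_contrast T (integrable_contrast T hvol f κ') f κ,
      Finset.sum_eq_single_of_mem κ hκ]
    · simp only [sq]
    · intro κ' hκ' hne
      exact integral_contrast_mul_contrast_of_ne T hvol hfi hne ((hS κ' hκ').trans (hS κ hκ).symm)
  have hHc : ∀ κ ∈ S, ∫ u, H u * contrast T f κ u ∂(addressMeasure T) = 0 := by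
    intro κ hκ
    have h1 : ∫ u, e * contrast T f κ u ∂(addressMeasure T) = 0 :=
      integral_addressMeasure_mul_contrast_eq_zero T hvol hfi κ ⟨0, hs⟩ (integrable_const e)
        fun _ _ => rfl
    simp only [hH, sub_mul]
    have i1 : Integrable (fun u => f (pointOf T u) * contrast T f κ u) (addressMeasure T) :=
      Integrable.mul_contrast T hFi f κ
    have i2 : Integrable (fun u => e * contrast T f κ u) (addressMeasure T) :=
      Integrable.mul_contrast T (integrable_const e) f κ
    have i3 : Integrable (fun u => f (pointOf T u) * contrast T f κ u - e * contrast T f κ u)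
      (addressMeasure T) := i1.sub i2
    rw [integral_sub i3 (Integrable.mul_contrast T hQi f κ), integral_sub i1 i2, h1, hQc κ hκ,
      integral_mul_contrast_self T hd hb hvol hT hfi]
    ring
  set A : (PermIndex s b → Equiv.Perm (Fin b)) → ℝ := fun σ =>
    ∑ i, H (scrambleDigits σ (a i)) with hA
  set B : (PermIndex s b → Equiv.Perm (Fin b)) → ℝ := fun σ =>
    ∑ i, Q (scrambleDigits σ (a i)) with hB
  have hAL : MemLp A 2 (scrambleMeasure s b) := memLp_finsetSum _ fun i _ =>
    hHL.comp_measurePreserving (hmp i)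
  have hBL : MemLp B 2 (scrambleMeasure s b) := memLp_finsetSum _ fun i _ =>
    hQL.comp_measurePreserving (hmp i)
  have hBsum : ∀ σ, B σ = ∑ κ ∈ S, ∑ i, contrast T f κ (scrambleDigits σ (a i)) := fun σ =>
    Finset.sum_comm
  have hWL : ∀ κ, MemLp (fun σ => ∑ i, contrast T f κ (scrambleDigits σ (a i))) 2
      (scrambleMeasure s b) := fun κ => memLp_finsetSum _ fun i _ =>
    (hcL κ).comp_measurePreserving (hmp i)
  have hAB : ∫ σ, A σ * B σ ∂(scrambleMeasure s b) = 0 := by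
    have h1 : ∀ σ, A σ * B σ
        = ∑ κ ∈ S, A σ * ∑ i, contrast T f κ (scrambleDigits σ (a i)) := fun σ => by
      rw [← Finset.mul_sum, ← hBsum]
    have h2 : ∀ κ, Integrable (fun σ => A σ * ∑ i, contrast T f κ (scrambleDigits σ (a i)))
      (scrambleMeasure s b) := fun κ => hAL.integrable_mul (hWL κ)
    simp only [h1]
    rw [integral_finsetSum _ fun κ _ => h2 κ]
    refine Finset.sum_eq_zero fun κ hκ => ?_
    rw [integral_sum_mul_sum_contrast T hvol hfi ha (hS κ hκ) hHi, hHc κ hκ, mul_zero]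
  have hBB : ∫ σ, B σ * B σ ∂(scrambleMeasure s b)
      = (b : ℝ) ^ m * ∑ κ ∈ S, ∫ u, contrast T f κ u ^ 2 ∂(addressMeasure T) := by
    have h1 : ∀ σ, B σ * B σ
        = ∑ κ ∈ S, B σ * ∑ i, contrast T f κ (scrambleDigits σ (a i)) := fun σ => by
      rw [← Finset.mul_sum, ← hBsum]
    have h2 : ∀ κ, Integrable (fun σ => B σ * ∑ i, contrast T f κ (scrambleDigits σ (a i)))
      (scrambleMeasure s b) := fun κ => hBL.integrable_mul (hWL κ)
    simp only [h1]
    rw [integral_finsetSum _ fun κ _ => h2 κ, Finset.mul_sum]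
    refine Finset.sum_congr rfl fun κ hκ => ?_
    rw [integral_sum_mul_sum_contrast T hvol hfi ha (hS κ hκ) hQi, hQc κ hκ]
  have hdec : ∀ σ, estimator T f a σ - e = 1 / (b : ℝ) ^ m * (A σ + B σ) := by
    intro σ
    have h1 : A σ + B σ = ∑ i, (f (scrambledPoint T σ (a i)) - e) := by
      simp only [hA, hB, hH, ← Finset.sum_add_distrib]
      refine Finset.sum_congr rfl fun i _ => ?_
      rw [sub_add_cancel]
      rfl
    rw [h1, Finset.sum_sub_distrib, Finset.sum_const, Finset.card_univ, Fintype.card_fin,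
      nsmul_eq_mul, estimator]
    push_cast
    field_simp
  rw [variance_eq_integral hest.aemeasurable, ← he]
  have hexp : ∀ σ, (estimator T f a σ - e) ^ 2
      = (1 / (b : ℝ) ^ m) ^ 2 * (A σ ^ 2 + 2 * (A σ * B σ) + B σ * B σ) := fun σ => by
    rw [hdec]
    ring
  simp only [hexp]
  have i1 : Integrable (fun σ => A σ ^ 2) (scrambleMeasure s b) := hAL.integrable_sq
  have i2 : Integrable (fun σ => A σ * B σ) (scrambleMeasure s b) := hAL.integrable_mul hBL
  have i3 : Integrable (fun σ => B σ * B σ) (scrambleMeasure s b) := hBL.integrable_mul hBL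
  have i4 : Integrable (fun σ => 2 * (A σ * B σ)) (scrambleMeasure s b) := i2.const_mul 2
  have i5 : Integrable (fun σ => A σ ^ 2 + 2 * (A σ * B σ)) (scrambleMeasure s b) := i1.add i4
  rw [integral_const_mul, integral_add i5 i3, integral_add i1 i4, integral_const_mul, hAB, hBB]
  have h0 : 0 ≤ ∫ σ, A σ ^ 2 ∂(scrambleMeasure s b) := integral_nonneg fun σ => sq_nonneg _
  have h5 : 1 / (b : ℝ) ^ m * ∑ κ ∈ S, ∫ u, contrast T f κ u ^ 2 ∂(addressMeasure T)
      = (1 / (b : ℝ) ^ m) ^ 2 * ((b : ℝ) ^ m *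
        ∑ κ ∈ S, ∫ u, contrast T f κ u ^ 2 ∂(addressMeasure T)) := by
    field_simp
  rw [h5]
  refine mul_le_mul_of_nonneg_left ?_ (sq_nonneg _)
  linarith

theorem exists_abs_le_of_holder (hT : ∀ j, (T j).Spherical) {f : Pt s d → ℝ} {D : GradFamily s d}
    (hD : IsMixedGradient (Set.univ.pi X) f D) (hH : HolderOn (Set.univ.pi X) D)
    (hd : 1 ≤ d) : ∃ M, ∀ x ∈ Set.univ.pi X, |f x| ≤ M := by
  obtain ⟨C, hC, hdiam⟩ := exists_common_diam T hT
  obtain ⟨B, β, hB, hβ, -, hH⟩ := hH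
  rcases (Set.univ.pi X).eq_empty_or_nonempty with he | ⟨y, hy⟩
  · exact ⟨0, by simp [he]⟩
  set r := C * (b : ℝ) ^ (-(((0 : ℕ) : ℝ) / (d : ℝ))) with hr
  refine ⟨|f y| + B * Real.sqrt (∑ _j : Fin s, r ^ 2) ^ β, fun x hx => ?_⟩
  have h1 : euclDist x y ≤ Real.sqrt (∑ _j : Fin s, r ^ 2) := by
    refine Real.sqrt_le_sqrt (Finset.sum_le_sum fun j _ => ?_)
    have h2 : ∀ z ∈ Set.univ.pi X, z j ∈ (T j).cellAt (fun _ => 0) 0 := fun z hz => by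
      rw [RecursiveSplit.cellAt, (T j).cell_zero]
      exact hz j trivial
    have h3 := hdiam j 0 (fun _ => 0) _ (h2 x hx) _ (h2 y hy)
    rw [dist_eq_norm] at h3
    exact pow_le_pow_left₀ (norm_nonneg _) h3 2
  have h4 : |f x - f y| ≤ B * euclDist x y ^ β := by
    have h5 := (abs_partials_sub_le (D := D) ∅ (fun _ => ⟨0, hd⟩) x y).trans (hH ∅ x hx y hy)
    rwa [partials, partials, hD.empty x hx, hD.empty y hy] at h5
  have h0 : 0 ≤ euclDist x y := Real.sqrt_nonneg _
  have h6 : B * euclDist x y ^ β ≤ B * Real.sqrt (∑ _j : Fin s, r ^ 2) ^ β := by gcongr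
  have h7 := abs_sub_abs_le_abs_sub (f x) (f y)
  linarith

end GeomNet
end

/-! ### Summation over the levels -/

open GeomNet in
theorem theorem1 {s d b : ℕ} [NeZero b] (hs : 1 ≤ s) (hd : 1 ≤ d) (hb : 2 ≤ b)
    (X : Fin s → Set (GeomNet.Block d)) (hvol : ∀ j, volume (X j) = 1)
    (hX : GeomNet.SobolExtensible (Set.univ.pi X))
    (T : ∀ j, GeomNet.RecursiveSplit b (X j)) (hT : ∀ j, (T j).Spherical)
    (f : GeomNet.Pt s d → ℝ) (hf : f ∈ GeomNet.SmoothClass (Set.univ.pi X))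
    (c₀ : ℝ) (hc₀ : 0 < c₀)
    (hA : ∀ (j : Fin s) (k : ℕ) (w : Fin k → Fin b),
      c₀ * (b : ℝ) ^ (-(2 * (k : ℝ) / (d : ℝ))) ≤
        GeomNet.minEigenvalue ((T j).centerMatrix_isHermitian k w)) :
    ∃ c : ℝ, 0 < c ∧ ∃ m₀ : ℕ, ∀ m : ℕ, m₀ ≤ m →
      ∀ a : Fin (b ^ m) → Fin s → ℝ, GeomNet.IsNet b 0 m a →
      ∀ (Ω : Type v) [MeasurableSpace Ω] (P : Measure Ω) [IsProbabilityMeasure P]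
        (π : GeomNet.PermIndex s b → Ω → Equiv.Perm (Fin b)),
        GeomNet.IsUniformScramble P π →
        MemLp (fun ω => GeomNet.estimator T f a (fun q => π q ω)) 2 P ∧
        c * Real.log ((b : ℝ) ^ m) ^ (s - 1) / ((b : ℝ) ^ m) ^ (1 + 2 / (d : ℝ)) ≤
          variance (fun ω => GeomNet.estimator T f a (fun q => π q ω)) P := by
  obtain ⟨D, hD, hH, hpos⟩ := hf
  have hb1 : (1 : ℝ) < b := by exact_mod_cast hb
  have hb0 : (0 : ℝ) < b := by linarith
  have hd0 : (0 : ℝ) < d := by exact_mod_cast hd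
  have hs0 : (0 : ℝ) < s := by exact_mod_cast hs
  have hlog : 0 < Real.log b := Real.log_pos hb1
  have hprob := isProbabilityMeasure_restrict hvol
  -- The nonzero integral for u = ∅ makes f integrable, which supplies its measurability;
  -- boundedness comes from the Hölder condition on the bounded region.
  have hfi : IntegrableOn f (Set.univ.pi X) :=
    (integrableOn_partials (hpos ∅) fun _ => ⟨0, hd⟩).congr_fun (fun x hx => hD.empty x hx _)
      (measurableSet_region T)
  obtain ⟨M, hM⟩ := exists_abs_le_of_holder T hT hD hH hd
  have hfL : MemLp f 2 (volume.restrict (Set.univ.pi X)) :=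
    MemLp.of_bound hfi.aestronglyMeasurable M (by
      filter_upwards [ae_restrict_mem (measurableSet_region T)] with x hx
      exact hM x hx)
  obtain ⟨c₁, hc₁, k₀, hk₀⟩ := exists_level_le_integral_contrast_sq T hd hb hvol hX hT hD hH
    (hpos Finset.univ) hfi hc₀ hA
  -- Since log n = m log b, the count (m / (4s))^(s-1) equals (log n)^(s-1) / (4 s log b)^(s-1). The
  -- bound on m is the one required by `le_card_levels`.
  refine ⟨c₁ / (4 * s * Real.log b) ^ (s - 1), by positivity, 2 * s * (k₀ + 1),
    fun m hm a ha Ω _ P _ π hπ => ?_⟩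
  have hest := memLp_estimator T hd hb hvol hT hfL a
  refine ⟨hest.comp_measurePreserving hπ.measurePreserving, ?_⟩
  rw [hπ.measurePreserving.variance_fun_comp hest.aemeasurable]
  have hvar := le_variance_estimator T hs hd hb hvol hT hfL ha (S := levels s m k₀)
    fun κ hκ => (mem_levels.1 hκ).1
  refine le_trans ?_ hvar
  have hR : ∀ κ ∈ levels s m k₀, c₁ * (b : ℝ) ^ (-(2 * (m : ℝ) / (d : ℝ)))
      ≤ ∫ u, contrast T f κ u ^ 2 ∂(addressMeasure T) := by
    intro κ hκ
    rw [mem_levels] at hκ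
    refine le_trans (le_of_eq ?_) (hk₀ κ hκ.2)
    rw [← Real.rpow_sum_of_pos hb0, ← hκ.1]
    congr 2
    push_cast
    rw [Finset.mul_sum, Finset.sum_div, Finset.sum_neg_distrib]
  have hcard := le_card_levels hs hm
  have hsum := Finset.card_nsmul_le_sum _ _ _ hR
  rw [nsmul_eq_mul] at hsum
  have hpow : ((b : ℝ) ^ m) ^ (1 + 2 / (d : ℝ))
      = (b : ℝ) ^ m * ((b : ℝ) ^ (-(2 * (m : ℝ) / (d : ℝ))))⁻¹ := by
    rw [Real.rpow_add (by positivity), Real.rpow_one, ← Real.rpow_neg hb0.le, neg_neg,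
      ← Real.rpow_natCast, ← Real.rpow_mul hb0.le]
    congr 2
    ring
  rw [hpow, Real.log_pow]
  set E := (b : ℝ) ^ (-(2 * (m : ℝ) / (d : ℝ))) with hE
  have hE0 : 0 < E := by positivity
  calc c₁ / (4 * s * Real.log b) ^ (s - 1) * (m * Real.log b) ^ (s - 1) / ((b : ℝ) ^ m * E⁻¹)
      = 1 / (b : ℝ) ^ m * (((m : ℝ) / (4 * s)) ^ (s - 1) * (c₁ * E)) := by
        rw [mul_pow (m : ℝ), mul_pow (4 * (s : ℝ)), div_pow]
        field_simp
    _ ≤ _ := by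
        refine mul_le_mul_of_nonneg_left (le_trans ?_ hsum) (by positivity)
        exact mul_le_mul_of_nonneg_right hcard (by positivity)
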